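/- Let $\alpha>-1$ be real and let $n\ge 0$ be an integer, both fixed. For $t\ge 0$ let $$w(x;t,\alpha)=x^{\alpha}e^{-x-t/x}\quad(x>0),\qquad \mu_j(t)=\int_0^\infty x^{j}\,w(x;t,\alpha)\,dx\quad(j=0,1,2,\ldots),$$ and let $D_n(t)=\det\big(\mu_{i+j}(t)\big)_{i,j=0}^{n-1}$ be the associated Hankel determinant, with $D_0(t)=1$. Then $D_n(t)>0$ for all sufficiently large $t$, and as $t\to+\infty$, $$\ln D_n(t)=-2n\sqrt t+\frac{n(2\alpha+n)}{4}\ln t+\widetilde C(n)+\frac{n\left[4(\alpha+n)^2-1\right]}{16\sqrt t}+O(t^{-1}),$$ where the implied constant may depend on $n$ and $\alpha$, and where $$\widetilde C(n)=\frac{n\ln\pi}{2}-\frac{n(n-1)\ln 2}{2}+\ln G(n+1).$$ Here $G$ is the Barnes $G$-function, $$G(1+z)=(2\pi)^{z/2}\exp\Big(-\frac{z+(1+\gamma)z^2}{2}\Big)\prod_{k=1}^{\infty}\Big(1+\frac zk\Big)^{k}\exp\Big(\frac{z^2}{2k}-z\Big),$$ with $\gamma$ the Euler–Mascheroni constant;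 it satisfies $G(z+1)=\Gamma(z)G(z)$ and $G(1)=1$. -/

import Mathlib

open Filter Asymptotics

/-- The singularly perturbed Laguerre weight `w(x; t, α) = x ^ α * exp (-x - t / x)`, used for `x > 0`. -/
noncomputable def laguerreWeight (t α x : ℝ) : ℝ :=
  x ^ α * Real.exp (-x - t / x)

/-- The `j`-th moment of the weight over `(0, ∞)`. -/
noncomputable def laguerreMoment (t α : ℝ) (j : ℕ) : ℝ :=
  ∫ x in Set.Ioi (0 : ℝ), x ^ j * laguerreWeight t α x

/-- The `n × n` Hankel determinant `det (μ_{i+j})`, with `0 ≤ i, j ≤ n - 1`; it is `1` for `n = 0`. -/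
noncomputable def hankelDet (n : ℕ) (t α : ℝ) : ℝ :=
  Matrix.det (Matrix.of fun i j : Fin n => laguerreMoment t α ((i : ℕ) + (j : ℕ)))

/-- The Barnes `G`-function on the real line, by its Weierstrass product: with `z = s - 1`,
`G (1 + z) = (2π)^(z/2) exp (-(z + (1 + γ) z²)/2) ∏_{k ≥ 1} (1 + z/k)^k exp (z²/(2k) - z)`,
where `γ` is the Euler–Mascheroni constant. The product index `m` below is `k - 1`. -/
noncomputable def barnesG (s : ℝ) : ℝ :=
  (2 * Real.pi) ^ ((s - 1) / 2) *
    Real.exp (-((s - 1) + (1 + Real.eulerMascheroniConstant) * (s - 1) ^ 2) / 2) *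
    ∏' m : ℕ, ((1 + (s - 1) / ((m : ℝ) + 1)) ^ (m + 1) *
      Real.exp ((s - 1) ^ 2 / (2 * ((m : ℝ) + 1)) - (s - 1)))

/-! For large `t` the weight concentrates at `x = √t`. The substitution `x = √t * exp (2 * θ)`,
`sinh θ = δ * v`, `4 * √t * δ ^ 2 = 1` makes the exponent exactly Gaussian: `x + t / x = 2 * √t + v
^ 2`. Andréief's identity (`integral_det_mul_det`) writes `n! * D_n` as an integral of a squared
Vandermonde determinant. Under the substitution this determinant becomes the one in `v` times
explicit factors, so `D_n` is a power of `t` times `exp (-2 * n * √t)` times a GUE integral with a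
factor tending to 1 as `δ → 0` (`hankelDet_eq_integral`). Only the even part of that factor
contributes. It is `1 + δ ^ 2 * (4 * (α + n) ^ 2 - 1) / 2 * (∑ v i) ^ 2 + O(δ ^ 4)`, and the trace
`∑ v i` has GUE variance `n / 2`. As `δ ^ 2 = 1 / (4 * √t)`, this gives the `1 / √t` term with error
`O(1 / t)`. The constant is the GUE partition function, computed with Hermite polynomials; its
factorials form `barnesG (n + 1)`, which is evaluated from the Weierstrass product by Stirling's
formula. -/

/-! ### Andréief's identity -/

open MeasureTheory in
/-- **Andréief's identity** for the determinant of a matrix of pairings. -/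
theorem integral_det_mul_det {n : ℕ} (f g : Fin n → ℝ → ℝ)
    (h : ∀ i j, Integrable (fun x => f i x * g j x)) :
    ∫ v : Fin n → ℝ, (Matrix.of fun i j => f i (v j)).det * (Matrix.of fun i j => g i (v j)).det
      = n.factorial * (Matrix.of fun i j => ∫ x, f i x * g j x).det := by
  have expand : ∀ v : Fin n → ℝ,
      (Matrix.of fun i j => f i (v j)).det * (Matrix.of fun i j => g i (v j)).det
      = ∑ τ : Equiv.Perm (Fin n), ∑ σ : Equiv.Perm (Fin n),
        ((Equiv.Perm.sign σ : ℤ) : ℝ) * ((Equiv.Perm.sign τ : ℤ) : ℝ) *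
          ∏ j, (f (σ j) (v j) * g (τ j) (v j)) := by
    intro v
    rw [Matrix.det_apply', Matrix.det_apply', Finset.sum_mul_sum, Finset.sum_comm]
    refine Finset.sum_congr rfl fun τ _ => Finset.sum_congr rfl fun σ _ => ?_
    simp only [Matrix.of_apply, Finset.prod_mul_distrib]
    ring
  have hint : ∀ σ τ : Equiv.Perm (Fin n),
      Integrable (fun v : Fin n → ℝ => ∏ j, (f (σ j) (v j) * g (τ j) (v j))) := fun σ τ =>
    Integrable.fintype_prod (f := fun j x => f (σ j) x * g (τ j) x) fun j => h _ _
  simp_rw [expand]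
  rw [integral_finsetSum _ fun τ _ => integrable_finsetSum _ fun σ _ => (hint σ τ).const_mul _]
  -- For fixed `τ` the sum over `σ` is, up to `sign τ`, the determinant with columns permuted by
  -- `τ`. The two signs cancel, so all `n!` values of `τ` contribute equally.
  have inner : ∀ τ : Equiv.Perm (Fin n),
      ∫ v : Fin n → ℝ, ∑ σ : Equiv.Perm (Fin n),
        ((Equiv.Perm.sign σ : ℤ) : ℝ) * ((Equiv.Perm.sign τ : ℤ) : ℝ) *
          ∏ j, (f (σ j) (v j) * g (τ j) (v j))
      = (Matrix.of fun i j => ∫ x, f i x * g j x).det := by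
    intro τ
    rw [integral_finsetSum _ fun σ _ => (hint σ τ).const_mul _]
    simp_rw [integral_const_mul]
    have hp : ∀ σ : Equiv.Perm (Fin n),
        ∫ v : Fin n → ℝ, ∏ j, (f (σ j) (v j) * g (τ j) (v j))
          = ∏ j, ∫ x, f (σ j) x * g (τ j) x := fun σ =>
      integral_fintype_prod_volume_eq_prod (fun j x => f (σ j) x * g (τ j) x)
    simp_rw [hp]
    set M : Matrix (Fin n) (Fin n) ℝ := Matrix.of fun i j => ∫ x, f i x * g j x with hM
    have h1 := Matrix.det_permute' τ M
    have h2 : (M.submatrix id τ).det = ∑ σ : Equiv.Perm (Fin n),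
        ((Equiv.Perm.sign σ : ℤ) : ℝ) * ∏ j, ∫ x, f (σ j) x * g (τ j) x := by
      rw [Matrix.det_apply']
      rfl
    have h3 : ((Equiv.Perm.sign τ : ℤ) : ℝ) * ((Equiv.Perm.sign τ : ℤ) : ℝ) = 1 := by
      rw [← Int.cast_mul, ← Units.val_mul, Int.units_mul_self]; simp
    calc _ = ((Equiv.Perm.sign τ : ℤ) : ℝ) * (M.submatrix id τ).det := by
            rw [h2, Finset.mul_sum]
            exact Finset.sum_congr rfl fun σ _ => by ring
      _ = M.det := by rw [h1, ← mul_assoc, h3, one_mul]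
  simp_rw [inner]
  rw [Finset.sum_const, Finset.card_univ, Fintype.card_perm, Fintype.card_fin, nsmul_eq_mul]

/-! ### Hermite polynomials and the GUE partition function -/

open Polynomial in
/-- The monic Hermite polynomials for the weight `exp (-x ^ 2)`. -/
noncomputable def monicHermite : ℕ → ℝ[X]
  | 0 => 1
  | k + 1 => X * monicHermite k - C (1 / 2) * derivative (monicHermite k)

open Polynomial in
theorem monicHermite_monic_natDegree (k : ℕ) :
    (monicHermite k).Monic ∧ (monicHermite k).natDegree = k := by
  induction k with
  | zero => simp [monicHermite]
  | succ k ih =>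
    obtain ⟨hm, hd⟩ := ih
    have hX : (X * monicHermite k).Monic := monic_X.mul hm
    have hXd : (X * monicHermite k).degree = ((k + 1 : ℕ) : WithBot ℕ) := by
      rw [degree_mul, degree_X, degree_eq_natDegree hm.ne_zero, hd]; push_cast; ring
    have hlt : (C (1 / 2) * derivative (monicHermite k)).degree < (X * monicHermite k).degree := by
      rw [hXd]
      calc (C (1 / 2) * derivative (monicHermite k)).degree
          ≤ (derivative (monicHermite k)).degree := by
            rw [degree_C_mul (by norm_num)]
        _ ≤ (monicHermite k).degree := degree_derivative_le
        _ = ((k : ℕ) : WithBot ℕ) := by rw [degree_eq_natDegree hm.ne_zero, hd]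
        _ < _ := by exact_mod_cast Nat.lt_succ_self k
    refine ⟨hX.sub_of_left hlt, ?_⟩
    rw [monicHermite, natDegree_eq_of_degree_eq (degree_sub_eq_left_of_degree_lt hlt),
      natDegree_eq_of_degree_eq_some hXd]

open MeasureTheory Polynomial in
theorem integrable_polynomial_mul_gaussian (p : ℝ[X]) :
    Integrable fun x : ℝ => p.eval x * Real.exp (-x ^ 2) := by
  induction p using Polynomial.induction_on' with
  | add p q hp hq =>
    refine (hp.add hq).congr (ae_of_all _ fun x => ?_)
    simp [add_mul]

  | monomial k a =>
    have := (integrable_rpow_mul_exp_neg_mul_sq (b := 1) one_pos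
      (s := k) (by linarith [k.cast_nonneg (α := ℝ)])).const_mul a
    simpa [mul_assoc] using this

-- Integration by parts: the recursion says that `H_{k+1} * exp (-x ^ 2)` is `-1/2` times the
-- derivative of `H_k * exp (-x ^ 2)`.
open MeasureTheory Polynomial in
theorem integral_monicHermite_succ_mul (k : ℕ) (q : ℝ[X]) :
    ∫ x : ℝ, (monicHermite (k + 1) * q).eval x * Real.exp (-x ^ 2)
      = 1 / 2 * ∫ x : ℝ, (monicHermite k * derivative q).eval x * Real.exp (-x ^ 2) := by
  set p := monicHermite k * q
  have hd : ∀ x : ℝ, HasDerivAt (fun x => p.eval x * Real.exp (-x ^ 2))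
      ((derivative p - C 2 * X * p).eval x * Real.exp (-x ^ 2)) x := by
    intro x
    have h1 := (p.hasDerivAt x).mul ((hasDerivAt_pow 2 x).neg.exp)
    convert! h1 using 1
    simp; ring
  have h0 := integral_eq_zero_of_hasDerivAt_of_integrable hd
    (integrable_polynomial_mul_gaussian _) (integrable_polynomial_mul_gaussian p)
  rw [← integral_const_mul, ← sub_eq_zero, ← integral_sub (integrable_polynomial_mul_gaussian _)
    ((integrable_polynomial_mul_gaussian _).const_mul _)]
  have h2 := congrArg (fun y : ℝ => -(1 / 2) * y) h0
  simp only [mul_zero] at h2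
  rw [← integral_const_mul] at h2
  rw [← h2]
  congr 1; ext x
  simp [p, monicHermite, derivative_mul]; ring

open MeasureTheory Polynomial in
theorem integral_monicHermite_mul (k : ℕ) (q : ℝ[X]) :
    ∫ x : ℝ, (monicHermite k * q).eval x * Real.exp (-x ^ 2)
      = (1 / 2) ^ k * ∫ x : ℝ, (derivative^[k] q).eval x * Real.exp (-x ^ 2) := by
  induction k generalizing q with
  | zero => simp [monicHermite]
  | succ k ih =>
    rw [integral_monicHermite_succ_mul, ih, Function.iterate_succ_apply, pow_succ]; ring

-- For `j ≤ i`, moving `i` derivatives onto the monic `H_j` gives `i!` if `j = i` and zero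
-- otherwise.
open MeasureTheory Polynomial in
theorem integral_monicHermite_mul_monicHermite (i j : ℕ) :
    ∫ x : ℝ, (monicHermite i).eval x * ((monicHermite j).eval x * Real.exp (-x ^ 2))
      = if i = j then (1 / 2) ^ i * i.factorial * √Real.pi else 0 := by
  have key : ∀ i j : ℕ, j ≤ i →
      ∫ x : ℝ, (monicHermite i).eval x * ((monicHermite j).eval x * Real.exp (-x ^ 2))
      = if i = j then (1 / 2) ^ i * i.factorial * √Real.pi else 0 := by
    intro i j hij
    have := integral_monicHermite_mul i (monicHermite j)
    simp only [eval_mul, mul_assoc] at this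
    rw [this]
    obtain ⟨hm, hd⟩ := monicHermite_monic_natDegree j
    split_ifs with h
    · subst h
      have hc : derivative^[i] (monicHermite i) = C (i.factorial : ℝ) := by
        rw [eq_C_of_natDegree_le_zero (p := derivative^[i] (monicHermite i))
          ((natDegree_iterate_derivative _ _).trans (by simp [hd]))]
        rw [coeff_iterate_derivative]
        have : (monicHermite i).coeff i = 1 := by simpa [hd] using hm.coeff_natDegree
        simp [this, Nat.descFactorial_self]
      have hg := integral_gaussian 1
      simp only [neg_mul, one_mul, div_one] at hg
      simp only [hc, eval_C, integral_const_mul, hg]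
      ring
    · rw [iterate_derivative_eq_zero (by omega)]
      simp
  rcases le_total j i with h | h
  · exact key i j h
  · have := key j i h
    simp_rw [mul_left_comm] at this
    rw [this]
    by_cases hij : i = j
    · simp [hij]
    · simp [hij, Ne.symm hij]

open MeasureTheory in
/-- The partition function of the Gaussian unitary ensemble. -/
theorem integral_vandermonde_sq_mul_gaussian (n : ℕ) :
    ∫ v : Fin n → ℝ, (Matrix.vandermonde v).det ^ 2 * Real.exp (-∑ i, v i ^ 2)
      = n.factorial * ∏ j ∈ Finset.range n, ((1 / 2) ^ j * (j.factorial : ℝ) * √Real.pi) := by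
  -- Monic polynomials of degrees `0, ..., n - 1` have the Vandermonde determinant; by orthogonality
  -- the Andréief matrix is then diagonal.
  have hdet : ∀ v : Fin n → ℝ,
      (Matrix.of fun i j : Fin n => (monicHermite i).eval (v j)).det
        = (Matrix.vandermonde v).det := by
    intro v
    rw [Matrix.det_eval_matrixOfPolynomials_eq_det_vandermonde v (fun i => monicHermite i)
      (fun i => (monicHermite_monic_natDegree i).2) (fun i => (monicHermite_monic_natDegree i).1),
      ← Matrix.det_transpose]
    rfl
  have hdet' : ∀ v : Fin n → ℝ,
      (Matrix.of fun i j : Fin n => (monicHermite i).eval (v j) * Real.exp (-v j ^ 2)).det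
        = (Matrix.vandermonde v).det * Real.exp (-∑ i, v i ^ 2) := by
    intro v
    rw [← hdet, ← Finset.sum_neg_distrib, Real.exp_sum, mul_comm, ← Matrix.det_mul_row]
    congr 1; ext i j; simp [mul_comm]
  have h := integral_det_mul_det (n := n) (fun i x => (monicHermite i).eval x)
    (fun i x => (monicHermite i).eval x * Real.exp (-x ^ 2)) (fun i j => by
      simpa [mul_assoc] using integrable_polynomial_mul_gaussian (monicHermite i * monicHermite j))
  simp_rw [hdet, hdet', integral_monicHermite_mul_monicHermite] at h
  simp_rw [sq, mul_assoc] at h ⊢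
  rw [h]
  congr 1
  have : (Matrix.of fun i j : Fin n => if (i : ℕ) = j then
      (1 / 2 : ℝ) ^ (i : ℕ) * (((i : ℕ).factorial : ℝ) * √Real.pi) else 0)
      = Matrix.diagonal fun i : Fin n =>
        (1 / 2 : ℝ) ^ (i : ℕ) * (((i : ℕ).factorial : ℝ) * √Real.pi) := by
    ext i j
    simp [Matrix.diagonal_apply, Fin.ext_iff]
  rw [this, Matrix.det_diagonal, Finset.prod_range]

/-! ### The Barnes function at positive integers -/

/-- The `m`-th factor of the Weierstrass product of the Barnes `G`-function at `1 + x`. -/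
noncomputable def barnesFactor (x : ℝ) (m : ℕ) : ℝ :=
  (1 + x / ((m : ℝ) + 1)) ^ (m + 1) * Real.exp (x ^ 2 / (2 * ((m : ℝ) + 1)) - x)

/-- The derivative of the left side is `y ^ 2 / (1 + y)`, between 0 and `3 * y ^ 2`. At `x / (m +
1)`, multiplied by `m + 1`, the left side is the logarithm of the `m`-th Barnes factor, which is
therefore summable. -/
theorem abs_log_one_add_sub_le {x : ℝ} (hx : 0 ≤ x) :
    |Real.log (1 + x) - x + x ^ 2 / 2| ≤ x ^ 3 := by
  have hpos : ∀ y : ℝ, 0 ≤ y → 0 < 1 + y := fun y hy => by linarith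
  have hd : ∀ y : ℝ, 0 ≤ y → HasDerivAt (fun y => Real.log (1 + y) - y + y ^ 2 / 2)
      (y ^ 2 / (1 + y)) y := by
    intro y hy
    have h := (((((hasDerivAt_id y).const_add 1).log (hpos y hy).ne').sub (hasDerivAt_id y)).add
      ((hasDerivAt_pow 2 y).div_const 2))
    convert! h using 1
    have := (hpos y hy).ne'
    simp only [id]
    field_simp
    push_cast; ring
  have hmono : MonotoneOn (fun y => Real.log (1 + y) - y + y ^ 2 / 2) (Set.Ici 0) := by
    refine monotoneOn_of_deriv_nonneg (convex_Ici 0)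
      (fun y hy => (hd y hy).continuousAt.continuousWithinAt)
      (fun y hy => (hd y (interior_subset hy)).differentiableAt.differentiableWithinAt) ?_
    intro y hy
    have hy' : 0 ≤ y := interior_subset hy
    rw [(hd y hy').deriv]
    have := hpos y hy'
    positivity
  have hanti : MonotoneOn (fun y => y ^ 3 - (Real.log (1 + y) - y + y ^ 2 / 2)) (Set.Ici 0) := by
    have hd' : ∀ y : ℝ, 0 ≤ y → HasDerivAt
        (fun y => y ^ 3 - (Real.log (1 + y) - y + y ^ 2 / 2)) (3 * y ^ 2 - y ^ 2 / (1 + y)) y := by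
      intro y hy
      convert! (hasDerivAt_pow 3 y).sub (hd y hy) using 1
    refine monotoneOn_of_deriv_nonneg (convex_Ici 0)
      (fun y hy => (hd' y hy).continuousAt.continuousWithinAt)
      (fun y hy => (hd' y (interior_subset hy)).differentiableAt.differentiableWithinAt) ?_
    intro y hy
    have hy' : 0 ≤ y := interior_subset hy
    rw [(hd' y hy').deriv]
    have : y ^ 2 / (1 + y) ≤ y ^ 2 := div_le_self (sq_nonneg y) (by linarith)
    nlinarith [sq_nonneg y]
  have h1 := hmono (Set.mem_Ici.2 le_rfl) (Set.mem_Ici.2 hx) hx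
  have h2 := hanti (Set.mem_Ici.2 le_rfl) (Set.mem_Ici.2 hx) hx
  simp at h1 h2
  rw [abs_of_nonneg h1]
  exact h2

theorem barnesFactor_pos {x : ℝ} (hx : 0 ≤ x) (m : ℕ) : 0 < barnesFactor x m := by
  unfold barnesFactor; positivity

theorem multipliable_barnesFactor {x : ℝ} (hx : 0 ≤ x) : Multipliable (barnesFactor x) := by
  refine Real.multipliable_of_summable_log (fun m => barnesFactor_pos hx m) ?_
  have hs : Summable fun m : ℕ => x ^ 3 * (1 / ((m : ℝ) + 1) ^ 2) := by
    refine Summable.mul_left _ ?_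
    have := (summable_nat_add_iff 1).2 (Real.summable_one_div_nat_pow (p := 2).2 one_lt_two)
    simpa using this
  refine Summable.of_norm_bounded hs fun m => ?_
  have hm : (0 : ℝ) < (m : ℝ) + 1 := by positivity
  have hb := abs_log_one_add_sub_le (div_nonneg hx hm.le)
  have hlog : Real.log (barnesFactor x m)
      = ((m : ℝ) + 1) * (Real.log (1 + x / ((m : ℝ) + 1)) - x / ((m : ℝ) + 1)
        + (x / ((m : ℝ) + 1)) ^ 2 / 2) := by
    unfold barnesFactor
    rw [Real.log_mul (by positivity) (by positivity), Real.log_exp, Real.log_pow]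
    push_cast
    field_simp
    ring
  rw [hlog, Real.norm_eq_abs, abs_mul, abs_of_pos hm]
  calc ((m : ℝ) + 1) * _ ≤ ((m : ℝ) + 1) * (x / ((m : ℝ) + 1)) ^ 3 :=
        mul_le_mul_of_nonneg_left hb hm.le
    _ = _ := by field_simp

theorem tendsto_prod_barnesFactor {x : ℝ} (hx : 0 ≤ x) :
    Tendsto (fun K => ∏ m ∈ Finset.range K, barnesFactor x m) atTop
      (nhds (∏' m, barnesFactor x m)) :=
  (multipliable_barnesFactor hx).hasProd.tendsto_prod_nat

/-- The finite form of `G (n + 2) = n! * G (n + 1)`: the ratio of partial products telescopes to a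
closed form whose limit can be computed. -/
theorem prod_barnesFactor_succ (n K : ℕ) :
    ∏ m ∈ Finset.range K, barnesFactor ((n : ℝ) + 1) m
      = (∏ m ∈ Finset.range K, barnesFactor (n : ℝ) m) *
        ((n.factorial : ℝ) * ((K : ℝ) + n + 1) ^ K / ((K + n).factorial : ℝ) *
          Real.exp (((n : ℝ) + 1 / 2) * (harmonic K : ℝ) - K)) := by
  induction K with
  | zero =>
    have : (n.factorial : ℝ) ≠ 0 := by positivity
    simp [this]
  | succ K ih =>
    rw [Finset.prod_range_succ, Finset.prod_range_succ, ih, harmonic_succ]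
    have e1 : ((K + 1 + n).factorial : ℝ) = ((K : ℝ) + 1 + n) * ((K + n).factorial : ℝ) := by
      rw [show K + 1 + n = (K + n) + 1 by ring, Nat.factorial_succ]; push_cast; ring
    have hK : (0 : ℝ) < (K : ℝ) + 1 := by positivity
    have hK' : (0 : ℝ) < (K : ℝ) + 1 + n := by positivity
    have hf : ((K + n).factorial : ℝ) ≠ 0 := by positivity
    have e2 : Real.exp (((n : ℝ) + 1 / 2) * ((harmonic K + ((K + 1 : ℕ) : ℚ)⁻¹ : ℚ) : ℝ)
          - ((K + 1 : ℕ) : ℝ)) * Real.exp ((n : ℝ) ^ 2 / (2 * ((K : ℝ) + 1)) - n)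
        = Real.exp (((n : ℝ) + 1 / 2) * (harmonic K : ℝ) - K) *
          Real.exp (((n : ℝ) + 1) ^ 2 / (2 * ((K : ℝ) + 1)) - (n + 1)) := by
      rw [← Real.exp_add, ← Real.exp_add]
      congr 1
      push_cast
      field_simp
      ring
    have e3 : (1 + ((n : ℝ) + 1) / ((K : ℝ) + 1)) ^ (K + 1)
        = ((K : ℝ) + 1 + n + 1) ^ (K + 1) / ((K : ℝ) + 1) ^ (K + 1) := by
      rw [← div_pow]; congr 1; field_simp; ring
    have e4 : (1 + (n : ℝ) / ((K : ℝ) + 1)) ^ (K + 1)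
        = ((K : ℝ) + 1 + n) ^ (K + 1) / ((K : ℝ) + 1) ^ (K + 1) := by
      rw [← div_pow]; congr 1; field_simp
    set P := ∏ m ∈ Finset.range K, barnesFactor (n : ℝ) m
    unfold barnesFactor
    rw [e1, e3, e4]
    calc _ = P * (n.factorial * ((K : ℝ) + n + 1) ^ K / ((K + n).factorial : ℝ))
            * (((K : ℝ) + 1 + n + 1) ^ (K + 1) / ((K : ℝ) + 1) ^ (K + 1)) *
            (Real.exp (((n : ℝ) + 1 / 2) * (harmonic K : ℝ) - K) *
          Real.exp (((n : ℝ) + 1) ^ 2 / (2 * ((K : ℝ) + 1)) - (n + 1))) := by ring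
      _ = _ := by
        rw [← e2]
        have : (K : ℝ) + n + 1 = (K : ℝ) + 1 + n := by ring
        rw [this, pow_succ ((K : ℝ) + 1 + n)]
        push_cast
        field_simp

open Real in
theorem tendsto_barnesFactor_ratio (n : ℕ) :
    Tendsto (fun K : ℕ => (n.factorial : ℝ) * ((K : ℝ) + n + 1) ^ K / ((K + n).factorial : ℝ) *
        Real.exp (((n : ℝ) + 1 / 2) * (harmonic K : ℝ) - K)) atTop
      (nhds (n.factorial * Real.exp (n + 1) *
        Real.exp (((n : ℝ) + 1 / 2) * eulerMascheroniConstant) / √(2 * π))) := by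
  have h1 : Tendsto (fun K : ℕ => (1 + ((n : ℝ) + 1) / K) ^ K) atTop
      (nhds (Real.exp (n + 1))) := tendsto_one_add_div_pow_exp _
  have h2 : Tendsto (fun K : ℕ => Real.exp (((n : ℝ) + 1 / 2) * (harmonic K - Real.log K)))
      atTop (nhds (Real.exp (((n : ℝ) + 1 / 2) * eulerMascheroniConstant))) :=
    (Real.continuous_exp.tendsto _).comp (tendsto_harmonic_sub_log.const_mul _)
  have h3 : Tendsto (fun K : ℕ => Stirling.stirlingSeq K * √2) atTop (nhds (√π * √2)) :=
    Stirling.tendsto_stirlingSeq_sqrt_pi.mul_const _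
  have h4 : Tendsto (fun K : ℕ => ((K + n).factorial : ℝ) / (K.factorial * (K : ℝ) ^ n)) atTop
      (nhds 1) := by
    clear h1 h2 h3
    induction n with
    | zero =>
      refine tendsto_const_nhds.congr fun K => ?_
      have : (K.factorial : ℝ) ≠ 0 := by positivity
      simp [this]
    | succ n ih =>
      have h5 : Tendsto (fun K : ℕ => 1 + ((n : ℝ) + 1) / K) atTop (nhds (1 + 0)) :=
        (tendsto_const_div_atTop_nhds_zero_nat _).const_add 1
      have h6 := ih.mul h5
      simp only [add_zero, mul_one] at h6
      refine h6.congr' ?_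
      filter_upwards [eventually_gt_atTop 0] with K hK
      have hK' : (K : ℝ) ≠ 0 := by positivity
      have : (K.factorial : ℝ) ≠ 0 := by positivity
      rw [← add_assoc, Nat.factorial_succ]
      push_cast
      field_simp
      ring
  have h5 := (((h1.const_mul (n.factorial : ℝ)).mul h2).div (h3.mul h4) (by positivity))
  have hlim : √π * √2 * 1 = √(2 * π) := by
    rw [mul_one, mul_comm, Real.sqrt_mul (by norm_num)]
  rw [hlim] at h5
  refine h5.congr' ?_
  filter_upwards [eventually_gt_atTop 0] with K hK
  have hK' : (0 : ℝ) < K := by positivity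
  -- Replacing `harmonic K` by `harmonic K - log K` releases `K ^ (n + 1/2)`, which balances the
  -- `√K` of Stirling's formula and `(K + n)! ~ K! * K ^ n`.
  have e1 : Real.exp (((n : ℝ) + 1 / 2) * harmonic K - K)
      = Real.exp (((n : ℝ) + 1 / 2) * (harmonic K - Real.log K)) * ((K : ℝ) ^ n * √K) /
        Real.exp 1 ^ K := by
    have : (K : ℝ) ^ n * √K = Real.exp (((n : ℝ) + 1 / 2) * Real.log K) := by
      rw [mul_comm ((n : ℝ) + 1 / 2), ← Real.rpow_def_of_pos hK', Real.rpow_add hK',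
        Real.rpow_natCast, Real.sqrt_eq_rpow]
    rw [this, ← Real.exp_add, ← Real.exp_nat_mul, ← Real.exp_sub]
    congr 1; ring
  have e2 : ((K : ℝ) + n + 1) ^ K = (1 + ((n : ℝ) + 1) / K) ^ K * (K : ℝ) ^ K := by
    rw [← mul_pow]; congr 1; field_simp; ring
  have e3 : √(2 * (K : ℝ)) = √2 * √K := Real.sqrt_mul (by norm_num) _
  simp only [Pi.div_apply, Stirling.stirlingSeq]
  rw [e1, e2, e3, div_pow]
  have : (K.factorial : ℝ) ≠ 0 := by positivity
  have : ((K + n).factorial : ℝ) ≠ 0 := by positivity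
  have : √(K : ℝ) ≠ 0 := by positivity
  field_simp

theorem barnesG_eq (x : ℝ) : barnesG (x + 1) = (2 * Real.pi) ^ (x / 2) *
    Real.exp (-(x + (1 + Real.eulerMascheroniConstant) * x ^ 2) / 2) *
      ∏' m, barnesFactor x m := by
  simp only [barnesG, barnesFactor, add_sub_cancel_right]

/-- The factors `√(2 * π)` and `exp (n + 1 + (n + 1/2) * γ)` in the limit of the ratio cancel the
change in the prefactors exactly, leaving `n!`. -/
theorem barnesG_nat_add_two (n : ℕ) :
    barnesG (((n + 1 : ℕ) : ℝ) + 1) = n.factorial * barnesG ((n : ℝ) + 1) := by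
  have hn : (0 : ℝ) ≤ n := n.cast_nonneg
  have h1 := tendsto_prod_barnesFactor (x := (n : ℝ) + 1) (by linarith)
  have h2 := (tendsto_prod_barnesFactor hn).mul (tendsto_barnesFactor_ratio n)
  have h3 := tendsto_nhds_unique h1 (h2.congr fun K => (prod_barnesFactor_succ n K).symm)
  rw [barnesG_eq, barnesG_eq]
  push_cast
  rw [h3]
  have h2pi : (0 : ℝ) < 2 * Real.pi := by positivity
  have e1 : (2 * Real.pi) ^ (((n : ℝ) + 1) / 2) = (2 * Real.pi) ^ ((n : ℝ) / 2) * √(2 * Real.pi) := by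
    rw [Real.sqrt_eq_rpow, ← Real.rpow_add h2pi]; congr 1; ring
  have e2 : Real.exp (-((n : ℝ) + 1 + (1 + Real.eulerMascheroniConstant) * ((n : ℝ) + 1) ^ 2) / 2)
      * (Real.exp (n + 1) * Real.exp (((n : ℝ) + 1 / 2) * Real.eulerMascheroniConstant))
      = Real.exp (-((n : ℝ) + (1 + Real.eulerMascheroniConstant) * (n : ℝ) ^ 2) / 2) := by
    rw [← Real.exp_add, ← Real.exp_add]; congr 1; ring
  rw [e1, ← e2]
  have : √(2 * Real.pi) ≠ 0 := by positivity
  field_simp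

theorem barnesG_nat_add_one (n : ℕ) :
    barnesG ((n : ℝ) + 1) = ∏ j ∈ Finset.range n, (j.factorial : ℝ) := by
  induction n with
  | zero =>
    rw [barnesG_eq]
    simp [barnesFactor]
  | succ n ih => rw [barnesG_nat_add_two, ih, Finset.prod_range_succ, mul_comm]

/-! ### The change of variables to a perturbed Gaussian ensemble -/

/-- With `x = √t * exp (2 * θ)`, `x + t / x = 2 * √t * cosh (2 * θ) = 2 * √t + 4 * √t * sinh θ ^ 2`,
and the normalisation of `δ` turns the last term into `v ^ 2`. -/
theorem laguerreWeight_smul_exp {t δ : ℝ} (α : ℝ) (ht : 0 < t) (hδ : 4 * √t * δ ^ 2 = 1) (v : ℝ) :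
    laguerreWeight t α (√t * Real.exp (2 * Real.arsinh (δ * v)))
      = (√t ^ α * Real.exp (-2 * √t)) *
        (Real.exp (2 * α * Real.arsinh (δ * v)) * Real.exp (-v ^ 2)) := by
  have hs : 0 < √t := Real.sqrt_pos.2 ht
  set θ := Real.arsinh (δ * v) with hθ
  have hsinh : Real.sinh θ = δ * v := Real.sinh_arsinh _
  have hexp : √t * Real.exp (2 * θ) + t / (√t * Real.exp (2 * θ)) = 2 * √t + v ^ 2 := by
    have h1 : t / (√t * Real.exp (2 * θ)) = √t * Real.exp (-(2 * θ)) := by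
      rw [Real.exp_neg]
      have := Real.mul_self_sqrt ht.le
      field_simp
      rw [sq, this]
    have h2 : Real.exp (2 * θ) + Real.exp (-(2 * θ)) = 2 + 4 * Real.sinh θ ^ 2 := by
      have := Real.cosh_eq (2 * θ)
      rw [Real.cosh_two_mul, Real.cosh_sq] at this
      linarith
    rw [h1, ← mul_add, h2, hsinh]
    linear_combination v ^ 2 * hδ
  rw [laguerreWeight, Real.mul_rpow hs.le (Real.exp_pos _).le, ← Real.exp_mul,
    show -(√t * Real.exp (2 * θ)) - t / (√t * Real.exp (2 * θ)) = -2 * √t + -v ^ 2 by linarith,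
    Real.exp_add, show 2 * θ * α = 2 * α * θ by ring]
  ring

open MeasureTheory in
theorem laguerreMoment_eq_integral {t δ : ℝ} (α : ℝ) (ht : 0 < t) (hδ0 : 0 < δ)
    (hδ : 4 * √t * δ ^ 2 = 1) (k : ℕ) :
    laguerreMoment t α k = (√t ^ (α + 1 / 2) * Real.exp (-2 * √t)) *
      ∫ v : ℝ, (√t * Real.exp (2 * Real.arsinh (δ * v))) ^ k *
        (Real.exp (2 * (α + 1) * Real.arsinh (δ * v)) / √(1 + (δ * v) ^ 2) *
          Real.exp (-v ^ 2)) := by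
  have hs : 0 < √t := Real.sqrt_pos.2 ht
  set f : ℝ → ℝ := fun v => √t * Real.exp (2 * Real.arsinh (δ * v)) with hf
  have hmono : StrictMono f := by
    intro x y hxy
    have : Real.arsinh (δ * x) < Real.arsinh (δ * y) :=
      Real.arsinh_lt_arsinh.2 (mul_lt_mul_of_pos_left hxy hδ0)
    exact mul_lt_mul_of_pos_left (Real.exp_lt_exp.2 (by linarith)) hs
  have himage : f '' Set.univ = Set.Ioi 0 := by
    ext x
    simp only [Set.image_univ, Set.mem_range, Set.mem_Ioi]
    constructor
    · rintro ⟨v, rfl⟩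
      exact mul_pos hs (Real.exp_pos _)
    · intro hx
      refine ⟨Real.sinh (Real.log (x / √t) / 2) / δ, ?_⟩
      simp only [hf]
      rw [mul_div_cancel₀ _ hδ0.ne', Real.arsinh_sinh, mul_div_cancel₀ _ two_ne_zero,
        Real.exp_log (by positivity), mul_div_cancel₀ _ hs.ne']
  have hderiv : ∀ v, HasDerivAt f (f v * (2 * (δ / √(1 + (δ * v) ^ 2)))) v := by
    intro v
    have h := ((((hasDerivAt_id v).const_mul δ).arsinh.const_mul 2).exp).const_mul (√t)
    convert! h using 1
    simp [hf]
    ring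
  rw [laguerreMoment, ← himage, integral_image_eq_integral_abs_deriv_smul MeasurableSet.univ
    (fun v _ => (hderiv v).hasDerivWithinAt) (hmono.injective.injOn), setIntegral_univ,
    ← integral_const_mul]
  congr 1
  ext v
  have hfv : 0 < f v := mul_pos hs (Real.exp_pos _)
  have hc : 0 < √(1 + (δ * v) ^ 2) := by positivity
  rw [abs_of_pos (by positivity), smul_eq_mul, laguerreWeight_smul_exp α ht hδ]
  -- The normalisation gives `(2 * δ * √t) ^ 2 = √t`, so the constants of the Jacobian supply the
  -- extra half power.
  have h1 : √t ^ (α + 1 / 2) = √t ^ α * (√t * (2 * δ)) := by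
    rw [Real.rpow_add hs, ← Real.sqrt_eq_rpow]
    congr 1
    rw [Real.sqrt_eq_iff_mul_self_eq hs.le (by positivity)]
    linear_combination -√t * hδ
  have h2 : Real.exp (2 * (α + 1) * Real.arsinh (δ * v))
      = Real.exp (2 * α * Real.arsinh (δ * v)) * Real.exp (2 * Real.arsinh (δ * v)) := by
    rw [← Real.exp_add]; congr 1; ring
  rw [h1, h2]
  simp only [hf]
  field_simp

/-- The ratio `(1 + cosh (a - b)) / (1 + cosh (a + b))` in terms of `x = sinh a` and `y = sinh b`. -/
noncomputable def coshRatio (x y : ℝ) : ℝ :=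
  (1 + √(1 + x ^ 2) * √(1 + y ^ 2) - x * y) / (1 + √(1 + x ^ 2) * √(1 + y ^ 2) + x * y)

theorem coshRatio_sinh (a b : ℝ) :
    coshRatio (Real.sinh a) (Real.sinh b)
      = (1 + Real.cosh (a - b)) / (1 + Real.cosh (a + b)) := by
  have h : ∀ a, √(1 + Real.sinh a ^ 2) = Real.cosh a := fun a => by
    rw [add_comm, ← Real.cosh_sq, Real.sqrt_sq (Real.cosh_pos a).le]
  rw [coshRatio, h, h, Real.cosh_sub, Real.cosh_add]
  ring

/-- The left side is `4 * exp (2 * a + 2 * b) * sinh (a - b) ^ 2`. Here `sinh (a - b) ^ 2 = (cosh (a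
- b) - 1) * (cosh (a - b) + 1)`, while `(sinh a - sinh b) ^ 2 = (cosh (a - b) - 1) * (cosh (a + b) +
1)`. -/
theorem exp_two_mul_sub_sq (a b : ℝ) :
    (Real.exp (2 * a) - Real.exp (2 * b)) ^ 2 = 4 * (Real.sinh a - Real.sinh b) ^ 2 *
      (Real.exp (2 * a) * Real.exp (2 * b)) * coshRatio (Real.sinh b) (Real.sinh a) := by
  rw [coshRatio_sinh]
  simp only [Real.sinh_eq, Real.cosh_eq, Real.exp_neg, Real.exp_sub, Real.exp_add,
    two_mul, neg_sub, neg_add_rev]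
  have hp := Real.exp_pos a
  have hq := Real.exp_pos b
  generalize Real.exp a = p at *
  generalize Real.exp b = q at *
  field_simp
  ring

/-- The part of the transformed weight that is even in the integration variables. -/
noncomputable def evenFactor {n : ℕ} (u : Fin n → ℝ) : ℝ :=
  (∏ i, 1 / √(1 + u i ^ 2)) * ∏ i, ∏ j ∈ Finset.Ioi i, coshRatio (u i) (u j)

theorem prod_prod_Ioi_mul_eq_pow {n : ℕ} (a : Fin n → ℝ) :
    ∏ i, ∏ j ∈ Finset.Ioi i, (a j * a i) = ∏ i, a i ^ (n - 1) := by
  have := Finset.prod_prod_Ioi_mul_eq_prod_prod_off_diag (fun i _ : Fin n => a i)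
  rw [this, Finset.prod_comm' (t' := Finset.univ) (s' := fun i => {i}ᶜ)]
  · simp [Finset.card_compl]
  · intro x y; simp [eq_comm]

theorem prod_prod_Ioi_const (n : ℕ) {s : ℝ} (hs : 0 < s) :
    ∏ i : Fin n, ∏ _j ∈ Finset.Ioi i, s = s ^ ((n : ℝ) * (n - 1) / 2) := by
  have h := prod_prod_Ioi_mul_eq_pow (n := n) (fun _ => √s)
  simp only [Real.mul_self_sqrt hs.le] at h
  rw [h]
  rcases n with _ | n
  · simp
  · rw [Finset.prod_const, Finset.card_univ, Fintype.card_fin, Real.sqrt_eq_rpow, ← pow_mul,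
      ← Real.rpow_natCast, ← Real.rpow_mul hs.le]
    congr 1
    push_cast
    simp
    ring

/-- Each pair yields one factor `s`, because `s ^ 2 * 4 * δ ^ 2 = s`. Each index lies in `n - 1`
pairs, which raises the exponent `α + 1` of the weight and Jacobian to `α + n`. -/
theorem vandermonde_sq_mul_prod_eq {n : ℕ} {s δ : ℝ} (α : ℝ) (hs : 0 < s)
    (hδ : 4 * s * δ ^ 2 = 1) (v : Fin n → ℝ) :
    (Matrix.vandermonde fun i => s * Real.exp (2 * Real.arsinh (δ * v i))).det ^ 2 *
      ∏ i, (Real.exp (2 * (α + 1) * Real.arsinh (δ * v i)) / √(1 + (δ * v i) ^ 2) *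
          Real.exp (-v i ^ 2))
      = s ^ ((n : ℝ) * (n - 1) / 2) * ((Matrix.vandermonde v).det ^ 2 *
          (Real.exp (2 * (α + n) * ∑ i, Real.arsinh ((δ • v) i)) * evenFactor (δ • v)) *
          Real.exp (-∑ i, v i ^ 2)) := by
  have hpair : ∀ i j, (s * Real.exp (2 * Real.arsinh (δ * v j))
      - s * Real.exp (2 * Real.arsinh (δ * v i))) ^ 2
      = s * (v j - v i) ^ 2 * (Real.exp (2 * Real.arsinh (δ * v j)) *
        Real.exp (2 * Real.arsinh (δ * v i))) * coshRatio (δ * v i) (δ * v j) := by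
    intro i j
    have h := exp_two_mul_sub_sq (Real.arsinh (δ * v j)) (Real.arsinh (δ * v i))
    rw [Real.sinh_arsinh, Real.sinh_arsinh] at h
    rw [← mul_sub, mul_pow, h]
    linear_combination (s * (v j - v i) ^ 2 * (Real.exp (2 * Real.arsinh (δ * v j)) *
        Real.exp (2 * Real.arsinh (δ * v i))) * coshRatio (δ * v i) (δ * v j)) * hδ
  rw [Matrix.det_vandermonde, Matrix.det_vandermonde]
  simp only [← Finset.prod_pow]
  simp_rw [hpair, Finset.prod_mul_distrib, prod_prod_Ioi_const n hs]
  have h1 := prod_prod_Ioi_mul_eq_pow fun i => Real.exp (2 * Real.arsinh (δ * v i))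
  simp only [Finset.prod_mul_distrib] at h1
  rw [h1]
  have h2 : (∏ i, Real.exp (2 * Real.arsinh (δ * v i)) ^ (n - 1)) *
      ∏ i, (Real.exp (2 * (α + 1) * Real.arsinh (δ * v i)) / √(1 + (δ * v i) ^ 2))
      = Real.exp (2 * (α + n) * ∑ i, Real.arsinh (δ * v i)) *
        ∏ i, 1 / √(1 + (δ * v i) ^ 2) := by
    rw [Finset.mul_sum, Real.exp_sum, ← Finset.prod_mul_distrib, ← Finset.prod_mul_distrib]
    refine Finset.prod_congr rfl fun i _ => ?_
    rw [mul_div_assoc', mul_one_div, ← Real.exp_nat_mul, ← Real.exp_add]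
    congr 2
    -- The index `i : Fin n` forces `1 ≤ n`, so the truncated `n - 1` is the true one.
    rw [Nat.cast_sub (Nat.one_le_iff_ne_zero.2 (by rintro rfl; exact i.elim0))]
    push_cast; ring
  rw [← Finset.sum_neg_distrib, Real.exp_sum]
  simp only [evenFactor, Pi.smul_apply, smul_eq_mul]
  linear_combination (s ^ ((n : ℝ) * (n - 1) / 2) * (∏ i, ∏ j ∈ Finset.Ioi i, (v j - v i) ^ 2) *
    (∏ i, ∏ j ∈ Finset.Ioi i, coshRatio (δ * v i) (δ * v j)) * ∏ i, Real.exp (-v i ^ 2)) * h2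

open MeasureTheory in
theorem hankelDet_eq_integral {t δ : ℝ} (n : ℕ) (α : ℝ) (ht : 0 < t) (hδ0 : 0 < δ)
    (hδ : 4 * √t * δ ^ 2 = 1)
    (hint : ∀ k : ℕ, Integrable fun v : ℝ => (√t * Real.exp (2 * Real.arsinh (δ * v))) ^ k *
        (Real.exp (2 * (α + 1) * Real.arsinh (δ * v)) / √(1 + (δ * v) ^ 2) *
          Real.exp (-v ^ 2))) :
    n.factorial * hankelDet n t α = √t ^ (n * α + (n : ℝ) ^ 2 / 2) * Real.exp (-2 * n * √t) *
      ∫ v : Fin n → ℝ, (Matrix.vandermonde v).det ^ 2 *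
          (Real.exp (2 * (α + n) * ∑ i, Real.arsinh ((δ • v) i)) * evenFactor (δ • v)) *
          Real.exp (-∑ i, v i ^ 2) := by
  have hs : 0 < √t := Real.sqrt_pos.2 ht
  set A := √t ^ (α + 1 / 2) * Real.exp (-2 * √t) with hA
  set X : ℝ → ℝ := fun v => √t * Real.exp (2 * Real.arsinh (δ * v)) with hX
  set W : ℝ → ℝ := fun v => Real.exp (2 * (α + 1) * Real.arsinh (δ * v)) / √(1 + (δ * v) ^ 2) *
          Real.exp (-v ^ 2) with hW
  have hmat : (Matrix.of fun i j : Fin n => laguerreMoment t α ((i : ℕ) + (j : ℕ)))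
      = A • Matrix.of fun i j : Fin n => ∫ v, X v ^ (i : ℕ) * (X v ^ (j : ℕ) * W v) := by
    ext i j
    simp only [Matrix.of_apply, Matrix.smul_apply, smul_eq_mul, ← mul_assoc, ← pow_add]
    rw [laguerreMoment_eq_integral α ht hδ0 hδ]
  have handr := integral_det_mul_det (n := n) (fun i v => X v ^ (i : ℕ))
    (fun j v => X v ^ (j : ℕ) * W v) (fun i j => by
      refine (hint (i + j)).congr (ae_of_all _ fun v => ?_)
      simp only [hX, hW]
      ring)
  have hd1 : ∀ v : Fin n → ℝ, (Matrix.of fun i j : Fin n => X (v j) ^ (i : ℕ)).det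
      = (Matrix.vandermonde fun i => X (v i)).det := fun v => by
    rw [← Matrix.det_transpose]; rfl
  have hd2 : ∀ v : Fin n → ℝ, (Matrix.of fun i j : Fin n => X (v j) ^ (i : ℕ) * W (v j)).det
      = (Matrix.vandermonde fun i => X (v i)).det * ∏ i, W (v i) := fun v => by
    rw [← hd1, mul_comm, ← Matrix.det_mul_row]
    simp only [Matrix.of_apply, mul_comm]
  have hpt : ∀ v : Fin n → ℝ, (Matrix.vandermonde fun i => X (v i)).det *
      ((Matrix.vandermonde fun i => X (v i)).det * ∏ i, W (v i))
      = √t ^ ((n : ℝ) * (n - 1) / 2) * ((Matrix.vandermonde v).det ^ 2 *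
          (Real.exp (2 * (α + n) * ∑ i, Real.arsinh ((δ • v) i)) * evenFactor (δ • v)) *
          Real.exp (-∑ i, v i ^ 2)) := fun v => by
    rw [← mul_assoc, ← sq]
    exact vandermonde_sq_mul_prod_eq α hs hδ v
  simp_rw [hd1, hd2, hpt] at handr
  rw [integral_const_mul] at handr
  rw [hankelDet, hmat, Matrix.det_smul, Fintype.card_fin, mul_left_comm, ← handr, ← mul_assoc]
  congr 1
  -- The exponents of `√t` add up: `n * (α + 1/2) + n * (n - 1) / 2 = n * α + n ^ 2 / 2`.
  rw [hA, mul_pow, ← Real.rpow_natCast, ← Real.rpow_mul hs.le, ← Real.exp_nat_mul, mul_right_comm,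
    ← Real.rpow_add hs]
  congr 2 <;> ring

/-! ### A calculus of second-order expansions with global error bounds -/

/-- The `ℓ¹` norm on `Fin n → ℝ`. -/
noncomputable def absSum {n : ℕ} (u : Fin n → ℝ) : ℝ := ∑ i, |u i|

theorem absSum_nonneg {n : ℕ} (u : Fin n → ℝ) : 0 ≤ absSum u :=
  Finset.sum_nonneg fun _ _ => abs_nonneg _

theorem abs_le_absSum {n : ℕ} (u : Fin n → ℝ) (i : Fin n) : |u i| ≤ absSum u :=
  Finset.single_le_sum (f := fun i => |u i|) (fun _ _ => abs_nonneg _) (Finset.mem_univ i)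

theorem absSum_smul {n : ℕ} (τ : ℝ) (u : Fin n → ℝ) : absSum (τ • u) = |τ| * absSum u := by
  simp [absSum, abs_mul, Finset.mul_sum]

theorem continuous_absSum {n : ℕ} : Continuous (absSum : (Fin n → ℝ) → ℝ) := by
  unfold absSum; fun_prop

/-- At most exponential growth. -/
def ExpBounded {n : ℕ} (F : (Fin n → ℝ) → ℝ) : Prop :=
  ∃ C c : ℝ, 0 ≤ C ∧ 0 ≤ c ∧ ∀ u, |F u| ≤ C * Real.exp (c * absSum u)

/-- `F = 1 + Q` up to an error of fourth order at the origin and of at most exponential growth,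
where `Q` is at most quadratic. -/
def QuadApprox {n : ℕ} (F Q : (Fin n → ℝ) → ℝ) : Prop :=
  ∃ C c : ℝ, 0 ≤ C ∧ 0 ≤ c ∧ (∀ u, |F u - 1 - Q u| ≤ C * absSum u ^ 4 * Real.exp (c * absSum u)) ∧
    ∀ u, |Q u| ≤ C * absSum u ^ 2

theorem pow_le_factorial_mul_exp {x : ℝ} (hx : 0 ≤ x) (k : ℕ) : x ^ k ≤ k.factorial * Real.exp x := by
  have := Real.pow_div_factorial_le_exp x hx k
  rwa [div_le_iff₀' (by positivity)] at this

section ExpBounded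

variable {n : ℕ} {F G Q : (Fin n → ℝ) → ℝ}

theorem ExpBounded.of_le (hF : ExpBounded F) (h : ∀ u, |G u| ≤ |F u|) : ExpBounded G := by
  obtain ⟨C, c, hC, hc, hF⟩ := hF
  exact ⟨C, c, hC, hc, fun u => (h u).trans (hF u)⟩

theorem expBounded_absSum_pow_mul_exp (C : ℝ) (k : ℕ) {c : ℝ} (hc : 0 ≤ c) :
    ExpBounded fun u : Fin n → ℝ => C * absSum u ^ k * Real.exp (c * absSum u) := by
  refine ⟨|C| * k.factorial, c + 1, by positivity, by positivity, fun u => ?_⟩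
  have hM := absSum_nonneg u
  rw [abs_mul, abs_mul, abs_of_nonneg (pow_nonneg hM k), Real.abs_exp, add_mul, one_mul,
    Real.exp_add]
  have := mul_le_mul_of_nonneg_left (pow_le_factorial_mul_exp hM k)
    (mul_nonneg (abs_nonneg C) (Real.exp_pos (c * absSum u)).le)
  linarith

theorem ExpBounded.mul (hF : ExpBounded F) (hG : ExpBounded G) :
    ExpBounded fun u => F u * G u := by
  obtain ⟨C, c, hC, hc, hF⟩ := hF
  obtain ⟨D, d, hD, hd, hG⟩ := hG
  refine ⟨C * D, c + d, by positivity, by positivity, fun u => ?_⟩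
  rw [abs_mul, add_mul, Real.exp_add]
  calc _ ≤ _ := mul_le_mul (hF u) (hG u) (abs_nonneg _) (by positivity)
    _ = _ := by ring

theorem ExpBounded.add (hF : ExpBounded F) (hG : ExpBounded G) :
    ExpBounded fun u => F u + G u := by
  obtain ⟨C, c, hC, hc, hF⟩ := hF
  obtain ⟨D, d, hD, hd, hG⟩ := hG
  refine ⟨C + D, c + d, by positivity, by positivity, fun u => ?_⟩
  have hM := absSum_nonneg u
  calc |F u + G u| ≤ |F u| + |G u| := abs_add_le _ _
    _ ≤ C * Real.exp (c * absSum u) + D * Real.exp (d * absSum u) := add_le_add (hF u) (hG u)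
    _ ≤ C * Real.exp ((c + d) * absSum u) + D * Real.exp ((c + d) * absSum u) := by
        gcongr <;> linarith
    _ = _ := by ring

theorem ExpBounded.prod {ι : Type*} (s : Finset ι) {F : ι → (Fin n → ℝ) → ℝ}
    (hF : ∀ i ∈ s, ExpBounded (F i)) : ExpBounded fun u => ∏ i ∈ s, F i u := by
  classical
  induction s using Finset.induction_on with
  | empty => exact ⟨1, 0, by norm_num, le_rfl, fun u => by simp⟩
  | insert a s ha ih =>
    simp only [Finset.prod_insert ha]
    exact (hF a (Finset.mem_insert_self _ _)).mul
      (ih fun i hi => hF i (Finset.mem_insert_of_mem hi))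

theorem ExpBounded.comp_smul (hF : ExpBounded F) (τ : ℝ) : ExpBounded fun u => F (τ • u) := by
  obtain ⟨C, c, hC, hc, hF⟩ := hF
  refine ⟨C, c * |τ|, hC, by positivity, fun u => (hF _).trans_eq ?_⟩
  rw [absSum_smul, mul_assoc]

theorem expBounded_const (C : ℝ) : ExpBounded fun _ : Fin n → ℝ => C :=
  ⟨|C|, 0, abs_nonneg C, le_rfl, fun u => by simp⟩

theorem QuadApprox.quad_expBounded (h : QuadApprox F Q) : ExpBounded Q := by
  obtain ⟨C, c, hC, hc, -, hQ⟩ := h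
  refine (expBounded_absSum_pow_mul_exp C 2 le_rfl).of_le fun u => (hQ u).trans ?_
  have := absSum_nonneg u
  rw [zero_mul, Real.exp_zero, mul_one]
  exact le_abs_self _

theorem QuadApprox.expBounded (h : QuadApprox F Q) : ExpBounded F := by
  have hQ := h.quad_expBounded
  obtain ⟨C, c, hC, hc, hF, -⟩ := h
  have hR : ExpBounded fun u => F u - 1 - Q u :=
    (expBounded_absSum_pow_mul_exp C 4 hc).of_le fun u => (hF u).trans (le_abs_self _)
  exact ((hR.add (expBounded_const 1)).add hQ).of_le fun u => le_of_eq (by ring_nf)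

theorem QuadApprox.mul {F' Q' : (Fin n → ℝ) → ℝ} (h : QuadApprox F Q) (h' : QuadApprox F' Q') :
    QuadApprox (fun u => F u * F' u) fun u => Q u + Q' u := by
  obtain ⟨D, d, hD, hd, hF'⟩ := h'.expBounded
  obtain ⟨C, c, hC, hc, hF, hQ⟩ := h
  obtain ⟨C', c', hC', hc', hG, hQ'⟩ := h'
  -- The first three terms bound the summands of `(F - 1 - Q) * F' + (1 + Q) * (F' - 1 - Q') + Q *
  -- Q'`; the surplus `C + C'` serves the bound on `Q + Q'`.
  refine ⟨C * D + (1 + 2 * C) * C' + C * C' + C + C', c + d + c' + 1, by positivity, by positivity,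
    fun u => ?_, fun u => ?_⟩
  · set M := absSum u
    have hM : 0 ≤ M := absSum_nonneg u
    have hM2 : M ^ 2 ≤ 2 * Real.exp M := by simpa using pow_le_factorial_mul_exp hM 2
    have hE1 : 1 ≤ Real.exp M := Real.one_le_exp hM
    have h1Q : |1 + Q u| ≤ (1 + 2 * C) * Real.exp M := by
      calc |1 + Q u| ≤ |1| + |Q u| := abs_add_le _ _
        _ ≤ 1 + C * M ^ 2 := by rw [abs_one]; exact add_le_add le_rfl (hQ u)
        _ ≤ Real.exp M + C * (2 * Real.exp M) := by gcongr
        _ = _ := by ring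
    have t1 : |(F u - 1 - Q u) * F' u| ≤ C * D * M ^ 4 * Real.exp ((c + d + c' + 1) * M) := by
      rw [abs_mul]
      calc _ ≤ (C * M ^ 4 * Real.exp (c * M)) * (D * Real.exp (d * M)) :=
            mul_le_mul (hF u) (hF' u) (abs_nonneg _) (by positivity)
        _ = C * D * M ^ 4 * Real.exp ((c + d) * M) := by rw [add_mul, Real.exp_add]; ring
        _ ≤ _ := mul_le_mul_of_nonneg_left (Real.exp_le_exp.2
            (mul_le_mul_of_nonneg_right (by linarith) hM)) (by positivity)
    have t2 : |(1 + Q u) * (F' u - 1 - Q' u)|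
        ≤ (1 + 2 * C) * C' * M ^ 4 * Real.exp ((c + d + c' + 1) * M) := by
      rw [abs_mul]
      calc _ ≤ ((1 + 2 * C) * Real.exp M) * (C' * M ^ 4 * Real.exp (c' * M)) :=
            mul_le_mul h1Q (hG u) (abs_nonneg _) (by positivity)
        _ = (1 + 2 * C) * C' * M ^ 4 * Real.exp ((c' + 1) * M) := by
            rw [add_mul c' 1 M, one_mul, Real.exp_add]; ring
        _ ≤ _ := mul_le_mul_of_nonneg_left (Real.exp_le_exp.2
            (mul_le_mul_of_nonneg_right (by linarith) hM)) (by positivity)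
    have t3 : |Q u * Q' u| ≤ C * C' * M ^ 4 * Real.exp ((c + d + c' + 1) * M) := by
      rw [abs_mul]
      calc _ ≤ (C * M ^ 2) * (C' * M ^ 2) :=
            mul_le_mul (hQ u) (hQ' u) (abs_nonneg _) (by positivity)
        _ = C * C' * M ^ 4 * 1 := by ring
        _ ≤ _ := by gcongr; exact Real.one_le_exp (by positivity)
    have t4 : 0 ≤ (C + C') * M ^ 4 * Real.exp ((c + d + c' + 1) * M) := by positivity
    calc |F u * F' u - 1 - (Q u + Q' u)|
        = |(F u - 1 - Q u) * F' u + (1 + Q u) * (F' u - 1 - Q' u) + Q u * Q' u| := by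
          congr 1; ring
      _ ≤ |(F u - 1 - Q u) * F' u| + |(1 + Q u) * (F' u - 1 - Q' u)| + |Q u * Q' u| :=
          abs_add_three _ _ _
      _ ≤ _ := by linarith
  · have hM := absSum_nonneg u
    calc |Q u + Q' u| ≤ |Q u| + |Q' u| := abs_add_le _ _
      _ ≤ C * absSum u ^ 2 + C' * absSum u ^ 2 := add_le_add (hQ u) (hQ' u)
      _ = (C + C') * absSum u ^ 2 := by ring
      _ ≤ _ := by
        gcongr
        have : 0 ≤ C * D + (1 + 2 * C) * C' + C * C' := by positivity
        linarith

theorem QuadApprox.one : QuadApprox (fun _ : Fin n → ℝ => 1) fun _ => 0 :=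
  ⟨0, 0, le_rfl, le_rfl, fun u => by simp, fun u => by simp⟩

theorem QuadApprox.prod {ι : Type*} (s : Finset ι) {F Q : ι → (Fin n → ℝ) → ℝ}
    (h : ∀ i ∈ s, QuadApprox (F i) (Q i)) :
    QuadApprox (fun u => ∏ i ∈ s, F i u) fun u => ∑ i ∈ s, Q i u := by
  classical
  induction s using Finset.induction_on with
  | empty => simpa using QuadApprox.one
  | insert a s ha ih =>
    simp only [Finset.prod_insert ha, Finset.sum_insert ha]
    exact (h a (Finset.mem_insert_self _ _)).mul
      (ih fun i hi => h i (Finset.mem_insert_of_mem hi))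

end ExpBounded

/-! ### Integration against the Gaussian -/

open MeasureTheory in
theorem integrable_mul_gaussian_of_abs_le {f : ℝ → ℝ} (hf : Continuous f) {C c : ℝ}
    (h : ∀ v, |f v| ≤ C * Real.exp (c * |v|)) :
    Integrable fun v => f v * Real.exp (-v ^ 2) := by
  have hg : Integrable fun v : ℝ => C * Real.exp (c ^ 2 / 2) * Real.exp (-(1 / 2) * v ^ 2) :=
    (integrable_exp_neg_mul_sq (by norm_num)).const_mul _
  refine hg.mono' (by fun_prop) (ae_of_all _ fun v => ?_)
  have hC : 0 ≤ C := by simpa using (abs_nonneg _).trans (h 0)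
  rw [Real.norm_eq_abs, abs_mul, Real.abs_exp]
  calc _ ≤ C * Real.exp (c * |v|) * Real.exp (-v ^ 2) := by gcongr; exact h v
    _ = C * Real.exp (c * |v| - v ^ 2) := by rw [mul_assoc, ← Real.exp_add]; rfl
    -- Half of the Gaussian absorbs the growth, by `c * |v| ≤ c ^ 2 / 2 + v ^ 2 / 2`.
    _ ≤ C * Real.exp (c ^ 2 / 2 + -(1 / 2) * v ^ 2) := by
        gcongr
        nlinarith [sq_nonneg (c - |v|), sq_abs v]
    _ = _ := by rw [Real.exp_add, mul_assoc]

open MeasureTheory in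
theorem ExpBounded.integrable_mul_gaussian {n : ℕ} {F : (Fin n → ℝ) → ℝ} (hF : ExpBounded F)
    (hc : Continuous F) : Integrable fun v => F v * Real.exp (-∑ i, v i ^ 2) := by
  obtain ⟨C, c, hC, -, hF⟩ := hF
  have h1 : Integrable fun v : ℝ => Real.exp (c * |v|) * Real.exp (-v ^ 2) :=
    integrable_mul_gaussian_of_abs_le (by fun_prop) (C := 1) (c := c) fun v => by simp
  have h2 := (Integrable.fintype_prod (μ := fun _ : Fin n => volume)
    (f := fun _ v => Real.exp (c * |v|) * Real.exp (-v ^ 2)) fun _ => h1).const_mul C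
  refine h2.mono' (by fun_prop) (ae_of_all _ fun v => ?_)
  rw [Real.norm_eq_abs, abs_mul, Real.abs_exp, Finset.prod_mul_distrib, ← Real.exp_sum,
    ← Real.exp_sum, ← Finset.mul_sum, Finset.sum_neg_distrib, ← mul_assoc]
  gcongr
  exact hF v

-- For `|τ| ≤ 1` the pointwise error at `τ • v` is at most `τ ^ 4` times one integrable function
-- independent of `τ`. The error bound being global, no splitting into near and far regions is
-- needed.
open MeasureTheory in
theorem QuadApprox.abs_integral_sub_le {n : ℕ} {F Q G : (Fin n → ℝ) → ℝ} (h : QuadApprox F Q)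
    (hFc : Continuous F) (hQc : Continuous Q) (hQ : ∀ (τ : ℝ) u, Q (τ • u) = τ ^ 2 * Q u)
    (hG : ExpBounded G) (hGc : Continuous G) :
    ∃ K, 0 ≤ K ∧ ∀ τ : ℝ, |τ| ≤ 1 → |(∫ v, G v * F (τ • v) * Real.exp (-∑ i, v i ^ 2))
      - (∫ v, G v * Real.exp (-∑ i, v i ^ 2))
      - τ ^ 2 * ∫ v, G v * Q v * Real.exp (-∑ i, v i ^ 2)| ≤ K * τ ^ 4 := by
  have hFb := h.expBounded
  have hQb := h.quad_expBounded
  obtain ⟨C, c, hC, hc, hF, -⟩ := h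
  refine ⟨∫ v, |G v| * (C * absSum v ^ 4 * Real.exp (c * absSum v)) * Real.exp (-∑ i, v i ^ 2),
    integral_nonneg fun v => ?_, fun τ hτ => ?_⟩
  · have := absSum_nonneg v
    positivity
  have i1 := (hG.mul (hFb.comp_smul τ)).integrable_mul_gaussian (by fun_prop)
  have i2 := hG.integrable_mul_gaussian hGc
  have i3 := ((hG.mul hQb).integrable_mul_gaussian (by fun_prop)).const_mul (τ ^ 2)
  have habs : ExpBounded fun v => |G v| := hG.of_le fun u => by simp
  have i4 := (habs.mul (expBounded_absSum_pow_mul_exp C 4 hc)).integrable_mul_gaussian (by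
    have := continuous_absSum (n := n)
    fun_prop)
  have i5 := integral_sub (i1.sub i2) i3
  simp only [Pi.sub_apply] at i5
  rw [← integral_const_mul, ← integral_sub i1 i2, ← i5,
    mul_comm _ (τ ^ 4), ← integral_const_mul]
  rw [← Real.norm_eq_abs]
  refine norm_integral_le_of_norm_le (i4.const_mul _) (ae_of_all _ fun v => ?_)
  have hM := absSum_nonneg v
  have key := hF (τ • v)
  rw [hQ, absSum_smul] at key
  have e1 : G v * F (τ • v) * Real.exp (-∑ i, v i ^ 2) - G v * Real.exp (-∑ i, v i ^ 2)
      - τ ^ 2 * (G v * Q v * Real.exp (-∑ i, v i ^ 2))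
      = G v * (F (τ • v) - 1 - τ ^ 2 * Q v) * Real.exp (-∑ i, v i ^ 2) := by ring
  simp only [e1, Real.norm_eq_abs, abs_mul, Real.abs_exp]
  have h4 : |τ| ^ 4 = τ ^ 4 := Even.pow_abs (by decide) τ
  calc _ ≤ |G v| * (C * (|τ| * absSum v) ^ 4 * Real.exp (c * (1 * absSum v))) *
        Real.exp (-∑ i, v i ^ 2) := by
        gcongr
        refine key.trans ?_
        gcongr
    _ = _ := by rw [mul_pow, h4]; ring_nf

/-! ### Elementary Taylor bounds -/

theorem abs_cosh_sub_le (z : ℝ) :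
    |Real.cosh z - 1 - z ^ 2 / 2| ≤ z ^ 4 * Real.exp |z| := by
  have h : ∀ z : ℝ, |Real.exp z - (1 + z + z ^ 2 / 2 + z ^ 3 / 6)| ≤ z ^ 4 * Real.exp |z| := by
    intro z
    have := Complex.norm_exp_sub_sum_le_norm_mul_exp (z : ℂ) 4
    rw [Complex.norm_real, Real.norm_eq_abs, Even.pow_abs (by decide)] at this
    refine le_trans (le_of_eq ?_) this
    rw [← Real.norm_eq_abs, ← Complex.norm_real]
    congr 1
    simp [Finset.sum_range_succ, Nat.factorial]
  have h1 := h z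
  have h2 := h (-z)
  rw [abs_neg] at h2
  rw [Real.cosh_eq]
  rw [abs_le] at *
  constructor <;> nlinarith [h1.1, h1.2, h2.1, h2.2]

theorem abs_arsinh_le (u : ℝ) : |Real.arsinh u| ≤ |u| := by
  have key : ∀ u : ℝ, 0 ≤ u → Real.arsinh u ≤ u := fun u hu => by
    have := Real.self_le_sinh_iff.2 (Real.arsinh_nonneg_iff.2 hu)
    rwa [Real.sinh_arsinh] at this
  rcases le_total 0 u with h | h
  · rw [abs_of_nonneg (Real.arsinh_nonneg_iff.2 h), abs_of_nonneg h]
    exact key u h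
  · rw [abs_of_nonpos (Real.arsinh_nonpos_iff.2 h), abs_of_nonpos h, ← Real.arsinh_neg]
    exact key _ (by linarith)

/-- The function `y ^ 3 - y + arsinh y` is increasing because `1 / √(1 + y ^ 2) ≥ 1 - y ^ 2`; the
other side is `arsinh u ≤ u`, and negative arguments follow by oddness. -/
theorem abs_arsinh_sub_le (u : ℝ) : |Real.arsinh u - u| ≤ |u| ^ 3 := by
  have hd : ∀ y : ℝ, HasDerivAt (fun y => y ^ 3 - y + Real.arsinh y)
      (3 * y ^ 2 - 1 + (√(1 + y ^ 2))⁻¹) y := fun y => by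
    convert! ((hasDerivAt_pow 3 y).sub (hasDerivAt_id y)).add (Real.hasDerivAt_arsinh y) using 1
  have hmono : Monotone fun y => y ^ 3 - y + Real.arsinh y := by
    refine monotone_of_deriv_nonneg (fun y => (hd y).differentiableAt) fun y => ?_
    rw [(hd y).deriv]
    have h1 : √(1 + y ^ 2) ≤ 1 + y ^ 2 := Real.sqrt_le_iff.2 ⟨by positivity, by nlinarith [sq_nonneg y]⟩
    have h2 : (1 + y ^ 2)⁻¹ ≤ (√(1 + y ^ 2))⁻¹ := inv_anti₀ (by positivity) h1
    have h3 : 1 - y ^ 2 ≤ (1 + y ^ 2)⁻¹ := by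
      rw [← one_div, le_div_iff₀ (by positivity)]
      nlinarith [sq_nonneg (y ^ 2)]
    nlinarith [sq_nonneg y]
  have key : ∀ u : ℝ, 0 ≤ u → |Real.arsinh u - u| ≤ |u| ^ 3 := fun u hu => by
    have h1 := hmono hu
    have h2 := abs_arsinh_le u
    rw [abs_of_nonneg (Real.arsinh_nonneg_iff.2 hu), abs_of_nonneg hu] at h2
    simp at h1
    rw [abs_of_nonpos (by linarith), abs_of_nonneg hu]
    linarith
  rcases le_total 0 u with h | h
  · exact key u h
  · have := key (-u) (by linarith)
    rwa [Real.arsinh_neg, abs_neg, ← neg_sub', abs_neg] at this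

theorem abs_one_div_sqrt_sub_le (x : ℝ) :
    |1 / √(1 + x ^ 2) - 1 - -(x ^ 2 / 2)| ≤ x ^ 4 := by
  set c := √(1 + x ^ 2) with hc
  have hsq : c ^ 2 = 1 + x ^ 2 := Real.sq_sqrt (by positivity)
  have hc1 : 1 ≤ c := Real.one_le_sqrt.2 (by nlinarith [sq_nonneg x])
  have e : 1 / c - 1 - -(x ^ 2 / 2) = (c - 1) ^ 2 * (c + 2) / (2 * c) := by
    rw [show x ^ 2 = c ^ 2 - 1 by linarith]
    field_simp; ring
  rw [e, abs_of_nonneg (by positivity), div_le_iff₀ (by positivity),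
    show x ^ 4 = (c ^ 2 - 1) ^ 2 by rw [hsq]; ring,
    show (c ^ 2 - 1) ^ 2 * (2 * c) = (c - 1) ^ 2 * ((c + 1) ^ 2 * (2 * c)) by ring]
  gcongr
  nlinarith

theorem coshRatio_den_ge_one (x y : ℝ) : 1 ≤ 1 + √(1 + x ^ 2) * √(1 + y ^ 2) + x * y := by
  have h : |x * y| ≤ √(1 + x ^ 2) * √(1 + y ^ 2) := by
    rw [abs_mul]
    gcongr <;> exact Real.abs_le_sqrt (by linarith)
  linarith [neg_abs_le (x * y)]

theorem abs_coshRatio_sub_le (x y M : ℝ) (hx : |x| ≤ M) (hy : |y| ≤ M) :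
    |coshRatio x y - 1 - -(x * y)| ≤ 2 * M ^ 4 := by
  have hD := coshRatio_den_ge_one x y
  have hsx : √(1 + x ^ 2) ^ 2 = 1 + x ^ 2 := Real.sq_sqrt (by positivity)
  have hsy : √(1 + y ^ 2) ^ 2 = 1 + y ^ 2 := Real.sq_sqrt (by positivity)
  have hx1 : 1 ≤ √(1 + x ^ 2) := Real.one_le_sqrt.2 (by nlinarith [sq_nonneg x])
  have hy1 : 1 ≤ √(1 + y ^ 2) := Real.one_le_sqrt.2 (by nlinarith [sq_nonneg y])
  have hM : 0 ≤ M := (abs_nonneg x).trans hx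
  have hxM : x ^ 2 ≤ M ^ 2 := by rw [← sq_abs]; gcongr
  have hyM : y ^ 2 ≤ M ^ 2 := by rw [← sq_abs]; gcongr
  have hxy : |x * y| ≤ M ^ 2 := by rw [abs_mul, sq]; gcongr
  unfold coshRatio
  set p := √(1 + x ^ 2)
  set q := √(1 + y ^ 2)
  have e : (1 + p * q - x * y) / (1 + p * q + x * y) - 1 - -(x * y)
      = x * y * (p * q - 1 + x * y) / (1 + p * q + x * y) := by
    have : 1 + p * q + x * y ≠ 0 := by linarith
    field_simp; ring
  have h1 : |p * q - 1 + x * y| ≤ 2 * M ^ 2 := by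
    have h2 : 0 ≤ p * q - 1 := by nlinarith
    -- By the arithmetic-geometric mean, `p * q ≤ (p ^ 2 + q ^ 2) / 2 = 1 + (x ^ 2 + y ^ 2) / 2`.
    have h3 : p * q - 1 ≤ M ^ 2 := by nlinarith [sq_nonneg (p - q)]
    rw [abs_le] at *
    constructor <;> linarith [hxy.1, hxy.2]
  rw [e, abs_div, abs_of_pos (by linarith : 0 < 1 + p * q + x * y), abs_mul]
  calc _ ≤ |x * y| * |p * q - 1 + x * y| := div_le_self (by positivity) hD
    _ ≤ M ^ 2 * (2 * M ^ 2) := by gcongr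
    _ = _ := by ring

/-! ### Second-order expansion of the perturbing factors -/

section QuadApprox

variable {n : ℕ}

theorem quadApprox_one_div_sqrt (i : Fin n) :
    QuadApprox (fun u => 1 / √(1 + u i ^ 2)) fun u => -(u i ^ 2 / 2) := by
  refine ⟨1, 0, one_pos.le, le_rfl, fun u => ?_, fun u => ?_⟩
  · have h := abs_one_div_sqrt_sub_le (u i)
    have : u i ^ 4 ≤ absSum u ^ 4 := by
      rw [← Even.pow_abs (by decide)]; gcongr; exact abs_le_absSum u i
    simpa using h.trans this
  · have : u i ^ 2 ≤ absSum u ^ 2 := by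
      rw [← sq_abs]; gcongr; exact abs_le_absSum u i
    rw [abs_neg, abs_of_nonneg (by positivity)]
    nlinarith [sq_nonneg (u i)]

theorem quadApprox_coshRatio (i j : Fin n) :
    QuadApprox (fun u => coshRatio (u i) (u j)) fun u => -(u i * u j) := by
  refine ⟨2, 0, two_pos.le, le_rfl, fun u => ?_, fun u => ?_⟩
  · simpa using abs_coshRatio_sub_le (u i) (u j) _ (abs_le_absSum u i) (abs_le_absSum u j)
  · have hM := absSum_nonneg u
    rw [abs_neg, abs_mul]
    calc _ ≤ absSum u * absSum u := mul_le_mul (abs_le_absSum u i) (abs_le_absSum u j)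
          (abs_nonneg _) hM
      _ ≤ _ := by nlinarith

/-- A cubic error in the linearisation `S` of `T` is enough, since `T ^ 2 - S ^ 2 = (T - S) * (T +
S)` is then of fourth order. -/
theorem quadApprox_cosh {T S : (Fin n → ℝ) → ℝ} (b : ℝ) (hT : ∀ u, |T u| ≤ absSum u)
    (hS : ∀ u, |S u| ≤ absSum u) (hTS : ∀ u, |T u - S u| ≤ absSum u ^ 3) :
    QuadApprox (fun u => Real.cosh (b * T u)) fun u => b ^ 2 / 2 * S u ^ 2 := by
  refine ⟨b ^ 4 + b ^ 2, |b|, by positivity, abs_nonneg b, fun u => ?_, fun u => ?_⟩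
  · set M := absSum u
    have hM : 0 ≤ M := absSum_nonneg u
    have h1 : |Real.cosh (b * T u) - 1 - (b * T u) ^ 2 / 2| ≤ b ^ 4 * M ^ 4 * Real.exp (|b| * M) := by
      refine (abs_cosh_sub_le _).trans ?_
      rw [mul_pow, abs_mul, ← Even.pow_abs (by decide : Even 4) (T u)]
      gcongr
      exacts [hT u, hT u]
    have h2 : |b ^ 2 / 2 * ((T u - S u) * (T u + S u))| ≤ b ^ 2 * M ^ 4 := by
      rw [abs_mul, abs_mul, abs_of_nonneg (by positivity : 0 ≤ b ^ 2 / 2)]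
      have h3 : |T u + S u| ≤ 2 * M := (abs_add_le _ _).trans (by linarith [hT u, hS u])
      calc _ ≤ b ^ 2 / 2 * (M ^ 3 * (2 * M)) := by gcongr; exact hTS u
        _ = _ := by ring
    have h4 : b ^ 2 * M ^ 4 ≤ b ^ 2 * M ^ 4 * Real.exp (|b| * M) :=
      le_mul_of_one_le_right (by positivity) (Real.one_le_exp (by positivity))
    calc _ = |(Real.cosh (b * T u) - 1 - (b * T u) ^ 2 / 2)
          + b ^ 2 / 2 * ((T u - S u) * (T u + S u))| := by congr 1; ring
      _ ≤ _ := (abs_add_le _ _).trans (by linarith)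
  · have hM := absSum_nonneg u
    have : S u ^ 2 ≤ absSum u ^ 2 := by rw [← sq_abs]; gcongr; exact hS u
    rw [abs_of_nonneg (by positivity)]
    nlinarith [mul_nonneg (sq_nonneg b) (sub_nonneg.2 this), sq_nonneg b, sq_nonneg (absSum u),
      mul_nonneg (sq_nonneg (b ^ 2)) (sq_nonneg (absSum u)),
      mul_nonneg (sq_nonneg b) (sq_nonneg (S u))]

theorem quadApprox_cosh_sum_arsinh (b : ℝ) :
    QuadApprox (fun u : Fin n → ℝ => Real.cosh (b * ∑ i, Real.arsinh (u i)))
      fun u => b ^ 2 / 2 * (∑ i, u i) ^ 2 := by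
  refine quadApprox_cosh b (fun u => ?_) (fun u => Finset.abs_sum_le_sum_abs _ _) fun u => ?_
  · exact (Finset.abs_sum_le_sum_abs _ _).trans (Finset.sum_le_sum fun i _ => abs_arsinh_le _)
  · rw [← Finset.sum_sub_distrib]
    calc _ ≤ ∑ i, |u i| ^ 3 := (Finset.abs_sum_le_sum_abs _ _).trans
          (Finset.sum_le_sum fun i _ => abs_arsinh_sub_le _)
      _ ≤ ∑ i, |u i| * absSum u ^ 2 := by
        refine Finset.sum_le_sum fun i _ => ?_
        rw [pow_succ']
        gcongr
        exact abs_le_absSum u i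
      _ = _ := by rw [← Finset.sum_mul, pow_succ' _ 2]; rfl

theorem quadApprox_cosh_sum (b : ℝ) :
    QuadApprox (fun u : Fin n → ℝ => Real.cosh (b * ∑ i, u i))
      fun u => b ^ 2 / 2 * (∑ i, u i) ^ 2 :=
  quadApprox_cosh b (fun u => Finset.abs_sum_le_sum_abs _ _)
    (fun u => Finset.abs_sum_le_sum_abs _ _) fun u => by
      have := absSum_nonneg u
      simp only [sub_self, abs_zero]
      positivity

theorem sum_sq_add_two_mul_sum_Ioi (u : Fin n → ℝ) :
    ∑ i, u i ^ 2 + 2 * ∑ i, ∑ j ∈ Finset.Ioi i, u i * u j = (∑ i, u i) ^ 2 := by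
  have h := Finset.sum_sum_Ioi_add_eq_sum_sum_off_diag (fun i j => u i * u j)
  have h1 : ∀ i, ∑ j ∈ ({i} : Finset (Fin n))ᶜ, u j * u i = (∑ j, u j) * u i - u i ^ 2 := by
    intro i
    rw [← Finset.sum_mul, eq_sub_iff_add_eq, sq, ← add_mul, add_comm,
      ← Finset.sum_singleton u i, Finset.sum_add_sum_compl, Finset.sum_singleton]
  have h2 : ∀ i, ∑ j ∈ Finset.Ioi i, (u j * u i + u i * u j)
      = 2 * ∑ j ∈ Finset.Ioi i, u i * u j := by
    intro i
    rw [Finset.mul_sum]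
    exact Finset.sum_congr rfl fun j _ => by ring
  simp_rw [h1, h2] at h
  rw [Finset.sum_sub_distrib, ← Finset.mul_sum, ← Finset.mul_sum, ← sq] at h
  linarith

/-- The terms `-(u i) ^ 2 / 2` and `-(u i * u j)` combine into a perfect square, so the trace is the
only statistic whose variance is required. -/
theorem quadApprox_evenFactor :
    QuadApprox (evenFactor : (Fin n → ℝ) → ℝ) fun u => -(1 / 2) * (∑ i, u i) ^ 2 := by
  have h := (QuadApprox.prod Finset.univ fun i _ => quadApprox_one_div_sqrt (n := n) i).mul
    (QuadApprox.prod Finset.univ fun i _ => QuadApprox.prod (Finset.Ioi i) fun j _ =>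
      quadApprox_coshRatio (n := n) i j)
  convert! h using 2 with u
  rw [← sum_sq_add_two_mul_sum_Ioi]
  simp only [Finset.sum_neg_distrib, ← Finset.sum_div]
  ring

theorem continuous_evenFactor : Continuous (evenFactor : (Fin n → ℝ) → ℝ) := by
  unfold evenFactor coshRatio
  refine (continuous_finsetProd _ fun i _ => ?_).mul
    (continuous_finsetProd _ fun i _ => continuous_finsetProd _ fun j _ => ?_)
  · exact continuous_const.div (by fun_prop) fun u => by positivity
  · exact Continuous.div (by fun_prop) (by fun_prop) fun u =>
      (zero_lt_one.trans_le (coshRatio_den_ge_one _ _)).ne'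

theorem evenFactor_neg (u : Fin n → ℝ) : evenFactor (-u) = evenFactor u := by
  simp [evenFactor, coshRatio]

end QuadApprox

/-! ### Symmetries of the GUE density and the variance of the trace -/

theorem det_vandermonde_sq {n : ℕ} (v : Fin n → ℝ) :
    (Matrix.vandermonde v).det ^ 2 = (∏ i, ∏ j ∈ Finset.Ioi i, (v j - v i)) ^ 2 := by
  rw [Matrix.det_vandermonde]

theorem continuous_det_vandermonde_sq {n : ℕ} :
    Continuous fun v : Fin n → ℝ => (Matrix.vandermonde v).det ^ 2 := by
  simp_rw [det_vandermonde_sq]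
  fun_prop

theorem expBounded_det_vandermonde_sq {n : ℕ} :
    ExpBounded fun v : Fin n → ℝ => (Matrix.vandermonde v).det ^ 2 := by
  have h : ExpBounded fun v : Fin n → ℝ => ∏ i, ∏ j ∈ Finset.Ioi i, (v j - v i) := by
    refine ExpBounded.prod _ fun i _ => ExpBounded.prod _ fun j _ => ?_
    refine (expBounded_absSum_pow_mul_exp 2 1 le_rfl).of_le fun u => ?_
    refine le_trans ((abs_sub _ _).trans (add_le_add (abs_le_absSum u j) (abs_le_absSum u i))) ?_
    simp only [pow_one, zero_mul, Real.exp_zero, mul_one]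
    linarith [le_abs_self (2 * absSum u)]
  simp_rw [det_vandermonde_sq, sq]
  exact h.mul h

theorem det_vandermonde_neg_sq {n : ℕ} (v : Fin n → ℝ) :
    (Matrix.vandermonde (-v)).det ^ 2 = (Matrix.vandermonde v).det ^ 2 := by
  simp only [det_vandermonde_sq, ← Finset.prod_pow]
  refine Finset.prod_congr rfl fun i _ => Finset.prod_congr rfl fun j _ => ?_
  simp only [Pi.neg_apply]
  ring

-- The density is invariant under `v ↦ -v`. Passing to the even part removes the odd orders in `δ`,
-- which `QuadApprox` does not allow.
open MeasureTheory in
theorem integral_vandermonde_mul_even_part {n : ℕ} {H : (Fin n → ℝ) → ℝ} (hH : ExpBounded H)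
    (hc : Continuous H) :
    ∫ v, (Matrix.vandermonde v).det ^ 2 * H v * Real.exp (-∑ i, v i ^ 2)
      = ∫ v, (Matrix.vandermonde v).det ^ 2 * ((H v + H (-v)) / 2) *
          Real.exp (-∑ i, v i ^ 2) := by
  have hcV := continuous_det_vandermonde_sq (n := n)
  have hint := (expBounded_det_vandermonde_sq.mul hH).integrable_mul_gaussian (hcV.mul hc)
  have hneg := integral_neg_eq_self
    (fun v : Fin n → ℝ => (Matrix.vandermonde v).det ^ 2 * H v * Real.exp (-∑ i, v i ^ 2)) volume
  have h2 := integral_add hint hint.comp_neg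
  rw [hneg] at h2
  simp only [det_vandermonde_neg_sq, Pi.neg_apply, neg_sq] at h2
  have h3 : ∀ v : Fin n → ℝ, (Matrix.vandermonde v).det ^ 2 * ((H v + H (-v)) / 2) *
      Real.exp (-∑ i, v i ^ 2) = 1 / 2 * ((Matrix.vandermonde v).det ^ 2 * H v *
      Real.exp (-∑ i, v i ^ 2) + (Matrix.vandermonde v).det ^ 2 * H (-v) *
      Real.exp (-∑ i, v i ^ 2)) := fun v => by ring
  simp_rw [h3]
  rw [integral_const_mul, h2]
  ring

theorem expBounded_exp_mul {n : ℕ} {T : (Fin n → ℝ) → ℝ} (b : ℝ) (hT : ∀ u, |T u| ≤ absSum u) :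
    ExpBounded fun u => Real.exp (b * T u) := by
  refine ⟨1, |b|, one_pos.le, abs_nonneg b, fun u => ?_⟩
  rw [Real.abs_exp, one_mul]
  refine Real.exp_le_exp.2 ((le_abs_self _).trans ?_)
  rw [abs_mul]
  exact mul_le_mul_of_nonneg_left (hT u) (abs_nonneg b)

-- The cosh is the even part of `exp (2 * τ * ∑ v i)`. Translating every coordinate by `τ` preserves
-- the Vandermonde determinant and completes the square, at the cost of `exp (n * τ ^ 2)`.
open MeasureTheory in
theorem integral_vandermonde_mul_cosh_sum {n : ℕ} (τ : ℝ) :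
    ∫ v : Fin n → ℝ, (Matrix.vandermonde v).det ^ 2 * Real.cosh (2 * ∑ i, (τ • v) i) *
        Real.exp (-∑ i, v i ^ 2)
      = Real.exp (n * τ ^ 2) *
        ∫ v : Fin n → ℝ, (Matrix.vandermonde v).det ^ 2 * Real.exp (-∑ i, v i ^ 2) := by
  have hH : ExpBounded fun v : Fin n → ℝ => Real.exp (2 * τ * ∑ i, v i) :=
    expBounded_exp_mul (2 * τ) fun u => Finset.abs_sum_le_sum_abs _ _
  have heven := integral_vandermonde_mul_even_part hH (by fun_prop)
  have hcosh : ∀ v : Fin n → ℝ, (Real.exp (2 * τ * ∑ i, v i) + Real.exp (2 * τ * ∑ i, (-v) i)) / 2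
      = Real.cosh (2 * ∑ i, (τ • v) i) := by
    intro v
    simp only [Pi.neg_apply, Pi.smul_apply, smul_eq_mul, Finset.sum_neg_distrib, ← Finset.mul_sum]
    rw [Real.cosh_eq]
    ring_nf
  simp_rw [hcosh] at heven
  rw [← heven, ← integral_sub_right_eq_self (fun v : Fin n → ℝ =>
    (Matrix.vandermonde v).det ^ 2 * Real.exp (-∑ i, v i ^ 2)) (fun _ => τ), ← integral_const_mul]
  congr 1
  ext v
  have h1 : (Matrix.vandermonde (v - fun _ : Fin n => τ)).det = (Matrix.vandermonde v).det :=
    Matrix.det_vandermonde_sub v τ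
  have h2 : ∑ i, (v - fun _ : Fin n => τ) i ^ 2 = ∑ i, v i ^ 2 - 2 * τ * ∑ i, v i + n * τ ^ 2 := by
    simp only [Pi.sub_apply, sub_sq, Finset.sum_add_distrib, Finset.sum_sub_distrib,
      Finset.mul_sum, Finset.sum_const, Finset.card_univ, Fintype.card_fin, nsmul_eq_mul]
    congr 2
    exact Finset.sum_congr rfl fun i _ => by ring
  rw [h1, h2, mul_left_comm, mul_assoc, ← Real.exp_add, ← Real.exp_add]
  ring_nf

open MeasureTheory in
/-- The trace of a matrix of the Gaussian unitary ensemble has variance `n / 2`. -/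
theorem integral_vandermonde_mul_sum_sq (n : ℕ) :
    ∫ v : Fin n → ℝ, (Matrix.vandermonde v).det ^ 2 * (∑ i, v i) ^ 2 * Real.exp (-∑ i, v i ^ 2)
      = n / 2 *
        ∫ v : Fin n → ℝ, (Matrix.vandermonde v).det ^ 2 * Real.exp (-∑ i, v i ^ 2) := by
  obtain ⟨K, hK, hest⟩ := (quadApprox_cosh_sum (n := n) 2).abs_integral_sub_le (by fun_prop)
    (by fun_prop) (fun τ u => by simp [← Finset.mul_sum]; ring)
    expBounded_det_vandermonde_sq continuous_det_vandermonde_sq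
  set I := ∫ v : Fin n → ℝ, (Matrix.vandermonde v).det ^ 2 * Real.exp (-∑ i, v i ^ 2)
  set M := ∫ v : Fin n → ℝ, (Matrix.vandermonde v).det ^ 2 * (∑ i, v i) ^ 2 *
    Real.exp (-∑ i, v i ^ 2) with hM
  have hQ : ∫ v : Fin n → ℝ, (Matrix.vandermonde v).det ^ 2 * (2 ^ 2 / 2 * (∑ i, v i) ^ 2) *
      Real.exp (-∑ i, v i ^ 2) = 2 * M := by
    rw [hM, ← integral_const_mul]
    congr 1; ext v; ring
  simp_rw [integral_vandermonde_mul_cosh_sum, hQ] at hest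
  -- With `x = τ ^ 2`, the slope at `0` is computed twice: from the closed form it is `n * I`, from
  -- the expansion of the cosh it is `2 * M`.
  have hd : HasDerivAt (fun x : ℝ => Real.exp (n * x) * I) (n * I) 0 := by
    simpa using (((hasDerivAt_id (0 : ℝ)).const_mul (n : ℝ)).exp).mul_const I
  have h1 := hd.tendsto_slope_zero_right
  simp only [zero_add, mul_zero, Real.exp_zero, one_mul, smul_eq_mul] at h1
  have h2 : Tendsto (fun x : ℝ => x⁻¹ * (Real.exp (n * x) * I - I)) (nhdsWithin 0 (Set.Ioi 0))
      (nhds (2 * M)) := by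
    rw [tendsto_iff_norm_sub_tendsto_zero]
    have h3 : Tendsto (fun x : ℝ => K * x) (nhdsWithin 0 (Set.Ioi 0)) (nhds 0) := by
      have : Tendsto (fun x : ℝ => K * x) (nhds 0) (nhds (K * 0)) :=
        (continuous_const_mul K).tendsto 0
      rw [mul_zero] at this
      exact this.mono_left nhdsWithin_le_nhds
    refine squeeze_zero' (Eventually.of_forall fun _ => norm_nonneg _) ?_ h3
    filter_upwards [Ioo_mem_nhdsGT (zero_lt_one (α := ℝ))] with x hx
    have hsq : √x ^ 2 = x := Real.sq_sqrt hx.1.le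
    have h4 := hest (√x) (by
      rw [abs_of_nonneg (Real.sqrt_nonneg x)]
      exact Real.sqrt_le_one.2 hx.2.le)
    rw [show √x ^ 4 = (√x ^ 2) ^ 2 by ring, hsq] at h4
    have e : x⁻¹ * (Real.exp (n * x) * I - I) - 2 * M
        = x⁻¹ * (Real.exp (n * x) * I - I - x * (2 * M)) := by
      have := hx.1.ne'
      field_simp
    rw [e, Real.norm_eq_abs, abs_mul, abs_of_pos (inv_pos.2 hx.1), inv_mul_le_iff₀ hx.1]
    linarith
  have h5 := tendsto_nhds_unique h1 h2
  linarith

/-! ### The perturbed integral to second order -/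

-- The cosh contributes `2 * a ^ 2` and the even factor `-1/2` to the coefficient of `(∑ v i) ^ 2`;
-- multiplying by the variance `n / 2` gives `n * (4 * a ^ 2 - 1) / 4`.
open MeasureTheory in
theorem exists_abs_integral_vandermonde_sub_le (n : ℕ) (a : ℝ) :
    ∃ K, 0 ≤ K ∧ ∀ δ : ℝ, |δ| ≤ 1 →
      |(∫ v : Fin n → ℝ, (Matrix.vandermonde v).det ^ 2 *
          (Real.exp (2 * a * ∑ i, Real.arsinh ((δ • v) i)) * evenFactor (δ • v)) *
          Real.exp (-∑ i, v i ^ 2))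
        - (1 + δ ^ 2 * (n * (4 * a ^ 2 - 1) / 4)) *
          ∫ v : Fin n → ℝ, (Matrix.vandermonde v).det ^ 2 * Real.exp (-∑ i, v i ^ 2)|
      ≤ K * δ ^ 4 := by
  have hcE := continuous_evenFactor (n := n)
  have hq := (quadApprox_cosh_sum_arsinh (n := n) (2 * a)).mul quadApprox_evenFactor
  have hcA : Continuous Real.arsinh := Real.continuous_arsinh
  obtain ⟨K, hK, hest⟩ := hq.abs_integral_sub_le (by fun_prop) (by fun_prop)
    (fun τ u => by simp [← Finset.mul_sum]; ring)
    expBounded_det_vandermonde_sq continuous_det_vandermonde_sq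
  refine ⟨K, hK, fun δ hδ => ?_⟩
  have h1 := hest δ hδ
  have hQ : ∫ v : Fin n → ℝ, (Matrix.vandermonde v).det ^ 2 *
      ((2 * a) ^ 2 / 2 * (∑ i, v i) ^ 2 + -(1 / 2) * (∑ i, v i) ^ 2) * Real.exp (-∑ i, v i ^ 2)
      = (4 * a ^ 2 - 1) / 2 * (n / 2 *
        ∫ v : Fin n → ℝ, (Matrix.vandermonde v).det ^ 2 * Real.exp (-∑ i, v i ^ 2)) := by
    rw [← integral_vandermonde_mul_sum_sq, ← integral_const_mul]
    congr 1; ext v; ring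
  have hb : ExpBounded fun v : Fin n → ℝ => Real.exp (2 * a * ∑ i, Real.arsinh ((δ • v) i)) *
      evenFactor (δ • v) :=
    ((expBounded_exp_mul (2 * a) (T := fun u : Fin n → ℝ => ∑ i, Real.arsinh (u i)) fun u =>
      (Finset.abs_sum_le_sum_abs _ _).trans
        (Finset.sum_le_sum fun i _ => abs_arsinh_le _)).mul
      quadApprox_evenFactor.expBounded).comp_smul δ
  have heven := integral_vandermonde_mul_even_part hb (by fun_prop)
  have hcosh : ∀ v : Fin n → ℝ,
      (Real.exp (2 * a * ∑ i, Real.arsinh ((δ • v) i)) * evenFactor (δ • v) +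
        Real.exp (2 * a * ∑ i, Real.arsinh ((δ • -v) i)) * evenFactor (δ • -v)) / 2
      = Real.cosh (2 * a * ∑ i, Real.arsinh ((δ • v) i)) * evenFactor (δ • v) := by
    intro v
    rw [smul_neg, evenFactor_neg, Real.cosh_eq]
    simp only [Pi.neg_apply, Real.arsinh_neg, Finset.sum_neg_distrib, mul_neg]
    ring
  simp_rw [hcosh] at heven
  rw [hQ, ← heven] at h1
  refine le_trans (le_of_eq ?_) h1
  congr 1
  ring

open MeasureTheory in
theorem integrable_transformed_weight {s δ : ℝ} (α : ℝ) (hs : 0 < s) (k : ℕ) :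
    Integrable fun v : ℝ => (s * Real.exp (2 * Real.arsinh (δ * v))) ^ k *
        (Real.exp (2 * (α + 1) * Real.arsinh (δ * v)) / √(1 + (δ * v) ^ 2) *
          Real.exp (-v ^ 2)) := by
  have hcA : Continuous Real.arsinh := Real.continuous_arsinh
  set b := 2 * (k : ℝ) + 2 * (α + 1)
  have h := integrable_mul_gaussian_of_abs_le (C := s ^ k) (c := |b| * |δ|)
    (f := fun v => s ^ k * Real.exp (b * Real.arsinh (δ * v)) / √(1 + (δ * v) ^ 2))
    (Continuous.div (by fun_prop) (by fun_prop) fun v => by positivity) fun v => by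
      have h1 : 1 ≤ √(1 + (δ * v) ^ 2) := Real.one_le_sqrt.2 (by nlinarith [sq_nonneg (δ * v)])
      have h2 : b * Real.arsinh (δ * v) ≤ |b| * |δ| * |v| := by
        refine (le_abs_self _).trans ?_
        rw [abs_mul, mul_assoc, ← abs_mul δ]
        exact mul_le_mul_of_nonneg_left (abs_arsinh_le _) (abs_nonneg b)
      rw [abs_of_nonneg (by positivity)]
      refine (div_le_self (by positivity) h1).trans ?_
      gcongr
  refine h.congr (ae_of_all _ fun v => ?_)
  have e : Real.exp (b * Real.arsinh (δ * v)) = Real.exp (2 * Real.arsinh (δ * v)) ^ k *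
      Real.exp (2 * (α + 1) * Real.arsinh (δ * v)) := by
    rw [← Real.exp_nat_mul, ← Real.exp_add]
    congr 1; ring
  simp only [e]
  ring

/-! ### Logarithms and the asymptotic formula -/

theorem log_prod_gaussian_norm (n : ℕ) :
    Real.log (∏ j ∈ Finset.range n, ((1 / 2) ^ j * (j.factorial : ℝ) * √Real.pi))
      = (n : ℝ) * Real.log Real.pi / 2 - (n : ℝ) * ((n : ℝ) - 1) * Real.log 2 / 2
        + Real.log (barnesG ((n : ℝ) + 1)) := by
  rw [barnesG_nat_add_one]
  have h1 : ∀ j : ℕ, (j.factorial : ℝ) ≠ 0 := fun j => by positivity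
  have h2 : ∀ j : ℕ, (1 / 2 : ℝ) ^ j * (j.factorial : ℝ) * √Real.pi ≠ 0 := fun j => by
    have := Real.pi_pos
    positivity
  induction n with
  | zero => simp
  | succ n ih =>
    rw [Finset.prod_range_succ, Finset.prod_range_succ,
      Real.log_mul (Finset.prod_ne_zero_iff.2 fun j _ => h2 j) (h2 n),
      Real.log_mul (Finset.prod_ne_zero_iff.2 fun j _ => h1 j) (h1 n), ih,
      Real.log_mul (by positivity) (by have := Real.pi_pos; positivity),
      Real.log_mul (by positivity) (h1 n), Real.log_pow, Real.log_sqrt Real.pi_pos.le,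
      one_div, Real.log_inv]
    push_cast
    ring

theorem abs_log_one_add_sub_self_le {x : ℝ} (hx : |x| ≤ 1 / 2) :
    |Real.log (1 + x) - x| ≤ 2 * x ^ 2 := by
  rw [abs_le] at hx
  have hpos : 0 < 1 + x := by linarith
  have h1 := Real.log_le_sub_one_of_pos hpos
  have h2 := Real.one_sub_inv_le_log_of_pos hpos
  have h3 : x - 2 * x ^ 2 ≤ 1 - (1 + x)⁻¹ := by
    have e : 1 - (1 + x)⁻¹ = x / (1 + x) := by field_simp; ring
    rw [e, le_div_iff₀ hpos]
    nlinarith [mul_nonneg (sq_nonneg x) (by linarith : 0 ≤ 1 + 2 * x)]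
  rw [abs_le]
  constructor <;> nlinarith [sq_nonneg x]

theorem exists_hankelDet_eq (n : ℕ) (α : ℝ) :
    ∃ K, 0 ≤ K ∧ ∀ t : ℝ, 1 ≤ t → ∃ r : ℝ,
      hankelDet n t α = √t ^ (n * α + (n : ℝ) ^ 2 / 2) * Real.exp (-2 * n * √t) *
        (∏ j ∈ Finset.range n, ((1 / 2) ^ j * (j.factorial : ℝ) * √Real.pi)) * r ∧
      |r - 1 - n * (4 * (α + n) ^ 2 - 1) / (16 * √t)| ≤ K * t⁻¹ := by
  obtain ⟨K, hK, hest⟩ := exists_abs_integral_vandermonde_sub_le n (α + n)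
  set P := ∏ j ∈ Finset.range n, ((1 / 2) ^ j * (j.factorial : ℝ) * √Real.pi) with hP
  have hPpos : 0 < P := Finset.prod_pos fun j _ => by
    have := Real.pi_pos
    positivity
  have hf : (0 : ℝ) < n.factorial := by positivity
  refine ⟨K / (n.factorial * P), by positivity, fun t ht => ?_⟩
  have ht0 : 0 < t := by linarith
  have hs : 0 < √t := Real.sqrt_pos.2 ht0
  have hs1 : 1 ≤ √t := Real.one_le_sqrt.2 ht
  -- This is the positive solution of `4 * √t * δ ^ 2 = 1`; `1 ≤ t` ensures `δ ≤ 1`.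
  set δ := 1 / (2 * √√t) with hδ
  have hδ0 : 0 < δ := by positivity
  have hδ2 : δ ^ 2 = 1 / (4 * √t) := by
    rw [hδ, div_pow, mul_pow, Real.sq_sqrt hs.le]; norm_num
  have hδs : 4 * √t * δ ^ 2 = 1 := by rw [hδ2]; field_simp
  have hδ1 : |δ| ≤ 1 := by
    rw [abs_of_pos hδ0]
    refine (div_le_one (by positivity)).2 ?_
    linarith [Real.one_le_sqrt.2 hs1]
  have hh := hankelDet_eq_integral n α ht0 hδ0 hδs (integrable_transformed_weight α hs)
  have he := hest δ hδ1
  set J := ∫ v : Fin n → ℝ, (Matrix.vandermonde v).det ^ 2 *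
          (Real.exp (2 * (α + n) * ∑ i, Real.arsinh ((δ • v) i)) * evenFactor (δ • v)) *
          Real.exp (-∑ i, v i ^ 2)
  rw [integral_vandermonde_sq_mul_gaussian, ← hP] at he
  refine ⟨J / (n.factorial * P), ?_, ?_⟩
  · rw [← mul_right_inj' hf.ne', hh]
    field_simp
  · have e : J / (n.factorial * P) - 1 - n * (4 * (α + n) ^ 2 - 1) / (16 * √t)
        = (J - (1 + δ ^ 2 * (n * (4 * (α + n) ^ 2 - 1) / 4)) * (n.factorial * P)) /
          (n.factorial * P) := by
      rw [hδ2]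
      field_simp
      ring
    have h4 : δ ^ 4 ≤ t⁻¹ := by
      rw [show δ ^ 4 = (δ ^ 2) ^ 2 by ring, hδ2, div_pow, mul_pow, Real.sq_sqrt ht0.le, one_pow,
        ← one_div]
      gcongr
      linarith
    rw [e, abs_div, abs_of_pos (by positivity : 0 < n.factorial * P), div_mul_eq_mul_div]
    gcongr
    exact he.trans (by gcongr)

theorem mainTheorem10 (n : ℕ) (α : ℝ) (hα : -1 < α) :
    (∀ᶠ t : ℝ in atTop, 0 < hankelDet n t α) ∧
    (fun t : ℝ => Real.log (hankelDet n t α) -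
        (-2 * (n : ℝ) * Real.sqrt t
          + (n : ℝ) * (2 * α + (n : ℝ)) / 4 * Real.log t
          + ((n : ℝ) * Real.log Real.pi / 2
              - (n : ℝ) * ((n : ℝ) - 1) * Real.log 2 / 2
              + Real.log (barnesG ((n : ℝ) + 1)))
          + (n : ℝ) * (4 * (α + (n : ℝ)) ^ 2 - 1) / (16 * Real.sqrt t)))
      =O[atTop] (fun t : ℝ => t⁻¹) := by
  obtain ⟨K, hK, h⟩ := exists_hankelDet_eq n α
  have hlogP := log_prod_gaussian_norm n
  set P := ∏ j ∈ Finset.range n, ((1 / 2) ^ j * (j.factorial : ℝ) * √Real.pi) with hP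
  have hPpos : 0 < P := Finset.prod_pos fun j _ => by
    have := Real.pi_pos
    positivity
  set κ := (n : ℝ) * (4 * (α + (n : ℝ)) ^ 2 - 1) with hκ
  set C := |κ| + K with hC
  have hC0 : 0 ≤ C := by positivity
  -- The correction satisfies `|r - 1| ≤ C / √t`. The threshold `4 * C ^ 2` makes this at most `1 /
  -- 2`, so `r > 0` and `log r = r - 1` up to `2 * (r - 1) ^ 2 = O(1 / t)`.
  have main : ∀ t : ℝ, max 1 (4 * C ^ 2) ≤ t → ∃ r : ℝ, 0 < r ∧
      hankelDet n t α = √t ^ (n * α + (n : ℝ) ^ 2 / 2) * Real.exp (-2 * n * √t) * P * r ∧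
      |Real.log r - κ / (16 * √t)| ≤ (2 * C ^ 2 + K) * t⁻¹ := by
    intro t ht
    have ht1 : 1 ≤ t := (le_max_left _ _).trans ht
    have ht2 : 4 * C ^ 2 ≤ t := (le_max_right _ _).trans ht
    have ht0 : 0 < t := by linarith
    have hs : 0 < √t := Real.sqrt_pos.2 ht0
    have hs1 : 1 ≤ √t := Real.one_le_sqrt.2 ht1
    have hss : √t ^ 2 = t := Real.sq_sqrt ht0.le
    obtain ⟨r, hr, hrb⟩ := h t ht1
    have hx : |r - 1| ≤ C / √t := by
      have h1 : |κ / (16 * √t)| ≤ |κ| / √t := by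
        rw [abs_div, abs_of_pos (by positivity : 0 < 16 * √t)]
        gcongr
        linarith
      have h2 : K * t⁻¹ ≤ K / √t := by
        rw [← div_eq_mul_inv]
        gcongr
        nlinarith
      calc |r - 1| = |(r - 1 - κ / (16 * √t)) + κ / (16 * √t)| := by congr 1; ring
        _ ≤ K * t⁻¹ + |κ / (16 * √t)| := (abs_add_le _ _).trans (by gcongr)
        _ ≤ K / √t + |κ| / √t := add_le_add h2 h1
        _ = _ := by rw [hC]; ring
    have hhalf : C / √t ≤ 1 / 2 := by
      have : 2 * C ≤ √t := Real.le_sqrt_of_sq_le (by linarith)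
      rw [div_le_iff₀ hs]
      linarith
    have hx2 : (r - 1) ^ 2 ≤ C ^ 2 * t⁻¹ := by
      rw [← sq_abs, ← div_eq_mul_inv, ← hss, ← div_pow]
      gcongr
    have hlog := abs_log_one_add_sub_self_le (hx.trans hhalf)
    rw [add_sub_cancel] at hlog
    refine ⟨r, by linarith [(abs_le.1 (hx.trans hhalf)).1], hr, ?_⟩
    calc |Real.log r - κ / (16 * √t)|
        = |(Real.log r - (r - 1)) + (r - 1 - κ / (16 * √t))| := by congr 1; ring
      _ ≤ 2 * (r - 1) ^ 2 + K * t⁻¹ := (abs_add_le _ _).trans (add_le_add hlog hrb)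
      _ ≤ _ := by linarith
  refine ⟨?_, IsBigO.of_bound (2 * C ^ 2 + K) ?_⟩
  · filter_upwards [eventually_ge_atTop (max 1 (4 * C ^ 2))] with t ht
    obtain ⟨r, hr0, hr, -⟩ := main t ht
    have : 0 < √t := Real.sqrt_pos.2 (by linarith [(le_max_left _ _).trans ht])
    rw [hr]
    positivity
  · filter_upwards [eventually_ge_atTop (max 1 (4 * C ^ 2))] with t ht
    obtain ⟨r, hr0, hr, hb⟩ := main t ht
    have ht0 : 0 < t := by linarith [(le_max_left _ _).trans ht]
    have hs : 0 < √t := Real.sqrt_pos.2 ht0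
    rw [Real.norm_eq_abs, Real.norm_eq_abs, abs_of_pos (inv_pos.2 ht0)]
    refine le_trans (le_of_eq ?_) hb
    congr 1
    rw [hr, Real.log_mul (by positivity) hr0.ne', Real.log_mul (by positivity) hPpos.ne',
      Real.log_mul (by positivity) (by positivity), Real.log_exp, Real.log_rpow hs,
      Real.log_sqrt ht0.le, hlogP]
    ring
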